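/- Let $\mathcal A\subset\mathbb R^3$ be a line. An \emph{affine rotation group with axis $\mathcal A$} is a group of affine maps $p\mapsto a+\varphi_t(p-a)$, $t\in\mathbb R$, where $a\in\mathcal A$ and $(\varphi_t)$ is a (differentiable) one-parameter subgroup of $\mathbf{SL}_3(\mathbb R)$ whose common fixed vectors are exactly the vectors parallel to $\mathcal A$; thus the points of $\mathcal A$ are exactly the fixed points of the group. Let $S$ be a surface of one of the following two kinds, whose Gaussian curvature $K$ is not identically zero: (a) a regular real-analytic parametrized surface $\mathbf x:U\to\mathbb R^3$ with $U\subset\mathbb R^2$ open and connected; or (b) the real zero set of an irreducible polynomial $F\in\mathbb R[x,y,z]$; here points, tangent planes, curvature and affine normals are those of all the regular real-analytic parametrized surfaces contained in $S$ (and $K\not\equiv0$ means that $K\neq 0$ at some point of such a surface, so in particular the real zero set is $2$-dimensional). $S$ is an \emph{affine rotation surface with axis $\mathcal A$} if it is invariant under some affine rotation group with axis $\mathcal A$. In case (b) this means that each map of the group maps $S$ into $S$; in case (a) invariance is local: for every $q\in U$ and every neighbourhood $V$ of $q$, the image of $\mathbf x(q)$ under the map with parameter $t$ lies in $\mathbf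 x(V)$ for all sufficiently small $|t|$. At a point with $K\ne0$ let $\nu=|K|^{-1/4}\mathbf N$ be the affine co-normal ($\mathbf N$ the Euclidean unit normal). The \emph{affine normal line} at this point is the line through it in the direction of the affine normal $\xi=[\nu,\nu_u,\nu_v]^{-1}\,(\nu_u\times\nu_v)$. $S$ has the \emph{shadow line property with respect to $\mathcal A$} if for every plane $\Pi\supset\mathcal A$ there is a single direction $v\neq 0$ that is tangent to $S$ at every point of the meridian $(S\cap\Pi)\setminus\mathcal A$ (the tangents, along the meridian, to the parallel curves, that is, to the curves conjugate to the meridians, are all parallel). Then $S$ is an affine rotation surface with axis $\mathcal A$ if and only if both of the following hold: (1) every affine normal line of $S$ (at the points with $K\neq0$) meets $\mathcal A$, possibly at infinity, i.e. it intersects $\mathcal A$ or is parallel to $\mathcal A$; (2) $S$ has the shadow line property with respect to $\mathcal A$. -/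

import Mathlib

open scoped Matrix Topology

noncomputable section

namespace AffineRotation

/-- Real 3-space in Cartesian coordinates.  Euclidean lengths are always written with the
dot product, the norm of the function space is never used as a length. -/
abbrev E3 : Type := Fin 3 → ℝ

/-! ### Lines, planes, affine rotation groups -/

/-- `A` is an affine line of 3-space. -/
def IsLine (A : AffineSubspace ℝ E3) : Prop :=
  ∃ a e : E3, e ≠ 0 ∧ A = AffineSubspace.mk' a (Submodule.span ℝ {e})

/-- The line through `p` in the direction `w` meets the line `A` in projective space:
they have a common point or they are parallel (they meet at infinity). -/
def MeetsLine (p w : E3) (A : AffineSubspace ℝ E3) : Prop :=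
  (∃ c : ℝ, p + c • w ∈ A) ∨ w ∈ A.direction

/-- `φ` is a one-parameter subgroup of `SL₃(ℝ)` whose fixed vectors are exactly the
elements of `D`. -/
structure IsRotationGroup (D : Submodule ℝ E3) (φ : ℝ → Matrix (Fin 3) (Fin 3) ℝ) : Prop where
  map_zero : φ 0 = 1
  map_add : ∀ s t, φ (s + t) = φ s * φ t
  det_eq_one : ∀ t, (φ t).det = 1
  differentiable : ∀ i j, Differentiable ℝ (fun t => φ t i j)
  fixed_iff : ∀ w : E3, (∀ t, φ t *ᵥ w = w) ↔ w ∈ D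

/-- The affine map with linear part `M` that fixes the point `a`. -/
def moveAbout (a : E3) (M : Matrix (Fin 3) (Fin 3) ℝ) (p : E3) : E3 := a + M *ᵥ (p - a)

/-! ### Parametrized surfaces -/

/-- Partial derivative with respect to the first parameter. -/
def dU (f : ℝ × ℝ → E3) (q : ℝ × ℝ) : E3 := fderiv ℝ f q (1, 0)

/-- Partial derivative with respect to the second parameter. -/
def dV (f : ℝ × ℝ → E3) (q : ℝ × ℝ) : E3 := fderiv ℝ f q (0, 1)

/-- The determinant `[a, b, c]`. -/
def triple (a b c : E3) : ℝ := a ⬝ᵥ (b ⨯₃ c)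

/-- A regular real-analytic parametrized surface. -/
structure Patch where
  /-- the parameter domain -/
  dom : Set (ℝ × ℝ)
  /-- the parametrization -/
  map : ℝ × ℝ → E3
  isOpen_dom : IsOpen dom
  analytic : AnalyticOnNhd ℝ map dom
  regular : ∀ q ∈ dom, dU map q ⨯₃ dV map q ≠ 0

/-- The tangent plane (as a linear subspace) at the parameter `q`. -/
def tangentPlane (x : ℝ × ℝ → E3) (q : ℝ × ℝ) : Submodule ℝ E3 :=
  Submodule.span ℝ {dU x q, dV x q}

/-- The Euclidean unit normal. -/
def unitNormal (x : ℝ × ℝ → E3) (q : ℝ × ℝ) : E3 :=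
  (Real.sqrt ((dU x q ⨯₃ dV x q) ⬝ᵥ (dU x q ⨯₃ dV x q)))⁻¹ • (dU x q ⨯₃ dV x q)

/-- The Gaussian curvature: determinant of the second fundamental form over that of the first. -/
def gaussCurvature (x : ℝ × ℝ → E3) (q : ℝ × ℝ) : ℝ :=
  ((dU (dU x) q ⬝ᵥ unitNormal x q) * (dV (dV x) q ⬝ᵥ unitNormal x q)
      - (dV (dU x) q ⬝ᵥ unitNormal x q) ^ 2)
    / ((dU x q ⬝ᵥ dU x q) * (dV x q ⬝ᵥ dV x q) - (dU x q ⬝ᵥ dV x q) ^ 2)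

/-- The affine co-normal vector `ν = |K|^(-1/4) N`. -/
def conormal (x : ℝ × ℝ → E3) (q : ℝ × ℝ) : E3 :=
  (|gaussCurvature x q| ^ (-(1 / 4) : ℝ)) • unitNormal x q

/-- The affine normal vector `ξ = [ν, ν_u, ν_v]⁻¹ (ν_u × ν_v)`, meaningful where `K ≠ 0`. -/
def affineNormal (x : ℝ × ℝ → E3) (q : ℝ × ℝ) : E3 :=
  (triple (conormal x q) (dU (conormal x) q) (dV (conormal x) q))⁻¹ •
    (dU (conormal x) q ⨯₃ dV (conormal x) q)

/-! ### The two conditions, for a surface described by a set of patches -/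

/-- The Gaussian curvature is not identically zero. -/
def NotDevelopable (P : Set Patch) : Prop :=
  ∃ X ∈ P, ∃ q ∈ X.dom, gaussCurvature X.map q ≠ 0

/-- Every affine normal line (these exist at the points with `K ≠ 0`) meets `A`. -/
def AffineNormalsMeet (P : Set Patch) (A : AffineSubspace ℝ E3) : Prop :=
  ∀ X ∈ P, ∀ q ∈ X.dom, gaussCurvature X.map q ≠ 0 →
    MeetsLine (X.map q) (affineNormal X.map q) A

/-- The shadow line property: for every plane `H` through `A` there is one direction `v` that is
tangent to the surface at all points, off the axis, of the meridian cut out by `H`, so that light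
in the direction `v` produces this meridian as a shadow line.  (A direction tangent to the surface
along a curve is conjugate to the curve: `v` is the common direction of the tangents, along the
meridian, to the parallel curves, i.e. to the curves conjugate to the meridians.) -/
def HasShadowLineProperty (P : Set Patch) (A : AffineSubspace ℝ E3) : Prop :=
  ∀ H : AffineSubspace ℝ E3, A ≤ H → Module.finrank ℝ H.direction = 2 →
    ∃ v : E3, v ≠ 0 ∧ ∀ X ∈ P, ∀ q ∈ X.dom, X.map q ∈ H → X.map q ∉ A →
      v ∈ tangentPlane X.map q

/-! ### Affine rotation surfaces -/

/-- A parametrized surface is an affine rotation surface with axis `A`: it is invariant under an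
affine rotation group with axis `A`.  As a patch has an edge, invariance is local: each point,
moved by a group element close to the identity, stays on the surface, close to where it was. -/
def Patch.IsAffineRotationSurface (X : Patch) (A : AffineSubspace ℝ E3) : Prop :=
  ∃ φ : ℝ → Matrix (Fin 3) (Fin 3) ℝ, IsRotationGroup A.direction φ ∧
    ∀ a ∈ A, ∀ q ∈ X.dom, ∀ V ∈ 𝓝 q,
      ∀ᶠ t in 𝓝 (0 : ℝ), moveAbout a (φ t) (X.map q) ∈ X.map '' V

/-- A subset of 3-space is an affine rotation surface with axis `A`: it is invariant under an
affine rotation group with axis `A`. -/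
def IsAffineRotationSet (S : Set E3) (A : AffineSubspace ℝ E3) : Prop :=
  ∃ φ : ℝ → Matrix (Fin 3) (Fin 3) ℝ, IsRotationGroup A.direction φ ∧
    ∀ a ∈ A, ∀ t, ∀ p ∈ S, moveAbout a (φ t) p ∈ S

/-- The real zero set of a polynomial. -/
def zeroSet (F : MvPolynomial (Fin 3) ℝ) : Set E3 := {p | MvPolynomial.eval p F = 0}

/-- All regular analytic patches lying on a set. -/
def patchesOf (S : Set E3) : Set Patch := {X | X.map '' X.dom ⊆ S}

end AffineRotation

end

/-!
Write the axis as `a + ℝ e`.  An affine rotation group is generated by a matrix `M` of trace zero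
whose kernel is `ℝ e`, and every such matrix generates one (`IsRotationGroup.exists_generator`,
`exists_isRotationGroup`).  Both directions of the theorem pass through the infinitesimal form of
invariance: the linear vector field `p ↦ M (p - a)` is tangent to the surface, that is,
`n · M (x - a) = 0` for the normal field `n = x_u × x_v`.

*Infinitesimal conditions.*  Let `D = [n, n_u, n_v]`.  Then `K = D / |n|⁴` and the co-normal is
`|D|^(-1/4) n`, so the affine normal has the direction of the vector `normalVec n D`, which is
polynomial in `n`, `D` and their first derivatives.  The affine normal line meets the axis exactly
if `[x - a, e, normalVec n D] = 0` (`meetsLine_affineNormal_iff`).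

*From tangency to the two conditions* (`properties_of_tangent`).  Along the tangent field one has
`∂n = -Mᵀ n - δ n` and `∂D = -4 δ D` with a function `δ`, so `Mᵀ n` annihilates the affine normal;
it also annihilates `x - a` and `e`, and the three vectors are coplanar
(`triple_normalVec_of_tangent`).  In the meridian plane through `a` spanned by `h` and `e`, the field
is everywhere a multiple of `M h`, which is the common direction required by the shadow line
property.

*From the two conditions to tangency* (`exists_generator`).  Near a generic point the surface is
`a + s b₁ + s t b₂ + z(s, t) e`, with `t` numbering the meridian planes.  The shadow line property
reads `a s z_s + z_t = c s` with functions `a`, `c` of `t` alone.  Inserted into the condition on the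
affine normals, this yields ordinary differential equations for `a` and `c`
(`exists_linear_tangent_field`), and these say exactly that, for `k` with `k' = -2 a k`, the function
`k` is a quadratic and `k c` a linear polynomial in `t` (`exists_linear_normalization`).  Hence `k`
times the shadow direction is a linear vector field of trace zero.  Its kernel is the axis because
the surface is curved (`ker_of_tangent`).

*From tangency at one place to invariance.*  For a parametrized surface, tangency spreads over the
connected domain by analyticity, and the integral curves of the field on the surface are orbits of
the group (`eventually_moveAbout_mem`).  For an irreducible polynomial `F`, the derivative of `F`
along the field vanishes on a piece of the surface, hence `F` divides it (`dvd_lieDeriv`, by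
elimination), and the uniqueness theorem for `f' = f h` keeps `F` zero along every orbit that starts
in the zero set (`eval_eq_zero_of_dvd`).

*From invariance to tangency.*  A curve on arbitrarily small pieces of a parametrized surface is
tangent to it (`nrm_dot_eq_zero_of_curve`); and a patch in the zero set of `F` transversal to the
group would sweep out an open set of zeros (`nrm_dot_eq_zero_of_invariant`).
-/

namespace AffineRotation

/-! ### Partial derivatives and vector algebra -/

section Calculus

variable {F G : Type*} [NormedAddCommGroup F] [NormedSpace ℝ F]
  [NormedAddCommGroup G] [NormedSpace ℝ G]

/-- The derivative of `f` at `q` in the direction `w`; `dU` and `dV` are its instances for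
`w = (1, 0)` and `w = (0, 1)`. -/
noncomputable def pd (w : ℝ × ℝ) (f : ℝ × ℝ → F) (q : ℝ × ℝ) : F := fderiv ℝ f q w

theorem dU_eq_pd (f : ℝ × ℝ → E3) : dU f = pd (1, 0) f := rfl

theorem dV_eq_pd (f : ℝ × ℝ → E3) : dV f = pd (0, 1) f := rfl

variable {w : ℝ × ℝ} {q : ℝ × ℝ}

theorem pd_congr {f g : ℝ × ℝ → F} (h : f =ᶠ[𝓝 q] g) : pd w f q = pd w g q := by
  rw [pd, pd, h.fderiv_eq]

theorem pd_const (c : F) : pd w (fun _ => c) q = 0 := by simp [pd]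

theorem pd_add {f g : ℝ × ℝ → F} (hf : AnalyticAt ℝ f q) (hg : AnalyticAt ℝ g q) :
    pd w (fun p => f p + g p) q = pd w f q + pd w g q := by
  simp [pd, fderiv_fun_add hf.differentiableAt hg.differentiableAt]

theorem pd_sub {f g : ℝ × ℝ → F} (hf : AnalyticAt ℝ f q) (hg : AnalyticAt ℝ g q) :
    pd w (fun p => f p - g p) q = pd w f q - pd w g q := by
  simp [pd, fderiv_fun_sub hf.differentiableAt hg.differentiableAt]

theorem pd_sub_const {f : ℝ × ℝ → F} (c : F) :
    pd w (fun p => f p - c) q = pd w f q := by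
  rw [pd, pd, fderiv_sub_const]

theorem pd_mul {f g : ℝ × ℝ → ℝ} (hf : AnalyticAt ℝ f q) (hg : AnalyticAt ℝ g q) :
    pd w (fun p => f p * g p) q = pd w f q * g q + f q * pd w g q := by
  simp [pd, fderiv_fun_mul hf.differentiableAt hg.differentiableAt]; ring

theorem pd_smul {f : ℝ × ℝ → ℝ} {g : ℝ × ℝ → F} (hf : DifferentiableAt ℝ f q)
    (hg : AnalyticAt ℝ g q) :
    pd w (fun p => f p • g p) q = pd w f q • g q + f q • pd w g q := by
  simp [pd, fderiv_fun_smul hf hg.differentiableAt, add_comm]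

theorem pd_clm (T : F →L[ℝ] G) {f : ℝ × ℝ → F} (hf : AnalyticAt ℝ f q) :
    pd w (fun p => T (f p)) q = T (pd w f q) := by
  have := (T.hasFDerivAt.comp q hf.differentiableAt.hasFDerivAt).fderiv
  simp only [pd]
  change fderiv ℝ (T ∘ f) q w = _
  rw [this]; rfl

theorem analyticAt_pd {f : ℝ × ℝ → F} [CompleteSpace F] (hf : AnalyticAt ℝ f q) :
    AnalyticAt ℝ (pd w f) q :=
  (ContinuousLinearMap.apply ℝ F w).analyticAt _ |>.comp hf.fderiv

theorem pd_comm {f : ℝ × ℝ → F} [CompleteSpace F] (hf : AnalyticAt ℝ f q) (w₁ w₂ : ℝ × ℝ) :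
    pd w₁ (pd w₂ f) q = pd w₂ (pd w₁ f) q := by
  have key : ∀ a b : ℝ × ℝ, pd a (pd b f) q = fderiv ℝ (fderiv ℝ f) q a b := fun a b =>
    pd_clm (ContinuousLinearMap.apply ℝ F b) hf.fderiv
  rw [key, key]
  have : IsSymmSndFDerivAt ℝ f q :=
    (hf.contDiffAt (n := 2)).isSymmSndFDerivAt (by simp)
  exact this w₁ w₂

theorem fderiv_apply_eq_pd (f : ℝ × ℝ → F) (q w : ℝ × ℝ) :
    fderiv ℝ f q w = w.1 • pd (1, 0) f q + w.2 • pd (0, 1) f q := by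
  rw [pd, pd, ← map_smul, ← map_smul, ← map_add]
  congr 1; ext <;> simp

/-- Chain rule for a change of parameters. -/
theorem pd_comp {f : ℝ × ℝ → F} {g : ℝ × ℝ → ℝ × ℝ} (hg : AnalyticAt ℝ g q)
    (hf : AnalyticAt ℝ f (g q)) :
    pd w (fun p => f (g p)) q =
      (pd w g q).1 • pd (1, 0) f (g q) + (pd w g q).2 • pd (0, 1) f (g q) := by
  have := (hf.differentiableAt.hasFDerivAt.comp q hg.differentiableAt.hasFDerivAt).fderiv
  rw [← fderiv_apply_eq_pd]
  change fderiv ℝ (f ∘ g) q w = _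
  rw [this]; rfl

theorem hasDerivAt_fst {f : ℝ × ℝ → F} {s t : ℝ} (hf : AnalyticAt ℝ f (s, t)) :
    HasDerivAt (fun s => f (s, t)) (pd (1, 0) f (s, t)) s :=
  hf.differentiableAt.hasFDerivAt.comp_hasDerivAt s
    ((hasDerivAt_id s).prodMk (hasDerivAt_const s t))

theorem hasDerivAt_snd {f : ℝ × ℝ → F} {s t : ℝ} (hf : AnalyticAt ℝ f (s, t)) :
    HasDerivAt (fun t => f (s, t)) (pd (0, 1) f (s, t)) t :=
  hf.differentiableAt.hasFDerivAt.comp_hasDerivAt t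
    ((hasDerivAt_const t s).prodMk (hasDerivAt_id t))

end Calculus

section Vector

variable {f g h : ℝ × ℝ → E3} {w q : ℝ × ℝ}

theorem pd_cross (hf : AnalyticAt ℝ f q) (hg : AnalyticAt ℝ g q) :
    pd w (fun p => f p ⨯₃ g p) q = pd w f q ⨯₃ g q + f q ⨯₃ pd w g q := by
  have := ((crossProduct (R := ℝ)).toContinuousBilinearMap.hasFDerivAt_of_bilinear
    hf.differentiableAt.hasFDerivAt hg.differentiableAt.hasFDerivAt).fderiv
  simp only [LinearMap.toContinuousBilinearMap_apply] at this
  simp [pd, this, add_comm]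

theorem analyticAt_cross (hf : AnalyticAt ℝ f q) (hg : AnalyticAt ℝ g q) :
    AnalyticAt ℝ (fun p => f p ⨯₃ g p) q :=
  ((crossProduct (R := ℝ)).toContinuousBilinearMap.analyticAt_bilinear (f q, g q)).comp₂ hf hg

theorem pd_dot (hf : AnalyticAt ℝ f q) (hg : AnalyticAt ℝ g q) :
    pd w (fun p => f p ⬝ᵥ g p) q = pd w f q ⬝ᵥ g q + f q ⬝ᵥ pd w g q := by
  have := ((dotProductBilin ℝ ℝ : E3 →ₗ[ℝ] E3 →ₗ[ℝ] ℝ).toContinuousBilinearMap.hasFDerivAt_of_bilinear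
    hf.differentiableAt.hasFDerivAt hg.differentiableAt.hasFDerivAt).fderiv
  simp only [LinearMap.toContinuousBilinearMap_apply, dotProductBilin] at this
  simp at this
  simp [pd, this, add_comm]

theorem analyticAt_dot (hf : AnalyticAt ℝ f q) (hg : AnalyticAt ℝ g q) :
    AnalyticAt ℝ (fun p => f p ⬝ᵥ g p) q :=
  ((dotProductBilin ℝ ℝ : E3 →ₗ[ℝ] E3 →ₗ[ℝ] ℝ).toContinuousBilinearMap.analyticAt_bilinear
    (f q, g q)).comp₂ hf hg

theorem pd_mulVec (M : Matrix (Fin 3) (Fin 3) ℝ) (hf : AnalyticAt ℝ f q) :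
    pd w (fun p => M *ᵥ f p) q = M *ᵥ pd w f q :=
  pd_clm (LinearMap.toContinuousLinearMap (Matrix.mulVecLin M)) hf

theorem analyticAt_mulVec (M : Matrix (Fin 3) (Fin 3) ℝ) (hf : AnalyticAt ℝ f q) :
    AnalyticAt ℝ (fun p => M *ᵥ f p) q :=
  ((LinearMap.toContinuousLinearMap (Matrix.mulVecLin M)).analyticAt _).comp hf

theorem pd_triple (hf : AnalyticAt ℝ f q) (hg : AnalyticAt ℝ g q) (hh : AnalyticAt ℝ h q) :
    pd w (fun p => triple (f p) (g p) (h p)) q =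
      triple (pd w f q) (g q) (h q) + triple (f q) (pd w g q) (h q) +
        triple (f q) (g q) (pd w h q) := by
  unfold triple
  rw [pd_dot hf (analyticAt_cross hg hh), pd_cross hg hh, dotProduct_add, add_assoc]

theorem analyticAt_triple (hf : AnalyticAt ℝ f q) (hg : AnalyticAt ℝ g q)
    (hh : AnalyticAt ℝ h q) : AnalyticAt ℝ (fun p => triple (f p) (g p) (h p)) q :=
  analyticAt_dot hf (analyticAt_cross hg hh)

end Vector

theorem triple_eq (a b c : E3) : triple a b c =
    a 0 * (b 1 * c 2 - b 2 * c 1) + a 1 * (b 2 * c 0 - b 0 * c 2) +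
      a 2 * (b 0 * c 1 - b 1 * c 0) := by
  simp [triple, cross_apply, dotProduct, Fin.sum_univ_three]

theorem dot_eq (a b : E3) : a ⬝ᵥ b = a 0 * b 0 + a 1 * b 1 + a 2 * b 2 := by
  simp [dotProduct, Fin.sum_univ_three]

theorem E3.ext_iff (a b : E3) : a = b ↔ a 0 = b 0 ∧ a 1 = b 1 ∧ a 2 = b 2 := by
  rw [funext_iff, Fin.forall_fin_succ, Fin.forall_fin_succ, Fin.forall_fin_succ]; simp

theorem cross_zero' (a b : E3) : (a ⨯₃ b) 0 = a 1 * b 2 - a 2 * b 1 := by simp [cross_apply]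
theorem cross_one' (a b : E3) : (a ⨯₃ b) 1 = a 2 * b 0 - a 0 * b 2 := by simp [cross_apply]
theorem cross_two' (a b : E3) : (a ⨯₃ b) 2 = a 0 * b 1 - a 1 * b 0 := by simp [cross_apply]

theorem dot_self_eq_zero {a : E3} : a ⬝ᵥ a = 0 ↔ a = 0 := dotProduct_self_eq_zero

theorem dot_self_pos {a : E3} (h : a ≠ 0) : 0 < a ⬝ᵥ a := by
  have h1 : 0 ≤ a ⬝ᵥ a := by rw [dot_eq]; nlinarith [sq_nonneg (a 0), sq_nonneg (a 1), sq_nonneg (a 2)]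
  exact lt_of_le_of_ne h1 fun h2 => h (dot_self_eq_zero.1 h2.symm)

/-! ### Curvature, co-normal and affine normal in terms of the normal field -/

/-- The (unnormalized) normal field `x_u × x_v`. -/
noncomputable def nrm (x : ℝ × ℝ → E3) (q : ℝ × ℝ) : E3 := dU x q ⨯₃ dV x q

/-- The determinant `[n, n_u, n_v]` of the unnormalized normal field `n`: it equals the determinant
of the second fundamental form with respect to `n`. -/
noncomputable def disc (x : ℝ × ℝ → E3) (q : ℝ × ℝ) : ℝ :=
  triple (nrm x q) (dU (nrm x) q) (dV (nrm x) q)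

/-- Up to a scalar factor, `ν_u × ν_v` for `ν = |D| ^ (-1 / 4) • n`. -/
noncomputable def normalVec (n : ℝ × ℝ → E3) (D : ℝ × ℝ → ℝ) (q : ℝ × ℝ) : E3 :=
  pd (1, 0) D q • (n q ⨯₃ pd (0, 1) n q) - pd (0, 1) D q • (n q ⨯₃ pd (1, 0) n q)
    - (4 * D q) • (pd (1, 0) n q ⨯₃ pd (0, 1) n q)

section

variable {x : ℝ × ℝ → E3} {q : ℝ × ℝ}

theorem analyticAt_nrm (hx : AnalyticAt ℝ x q) : AnalyticAt ℝ (nrm x) q :=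
  analyticAt_cross (analyticAt_pd hx) (analyticAt_pd hx)

theorem analyticAt_disc (hx : AnalyticAt ℝ x q) : AnalyticAt ℝ (disc x) q :=
  analyticAt_triple (analyticAt_nrm hx) (analyticAt_pd (analyticAt_nrm hx))
    (analyticAt_pd (analyticAt_nrm hx))

theorem nrm_dot_dU (x : ℝ × ℝ → E3) (q : ℝ × ℝ) : nrm x q ⬝ᵥ dU x q = 0 := by
  rw [nrm, dotProduct_comm, dot_self_cross]

theorem nrm_dot_dV (x : ℝ × ℝ → E3) (q : ℝ × ℝ) : nrm x q ⬝ᵥ dV x q = 0 := by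
  rw [nrm, dotProduct_comm, dot_cross_self]

theorem nrm_dot_pd (x : ℝ × ℝ → E3) (q w : ℝ × ℝ) : nrm x q ⬝ᵥ pd w x q = 0 := by
  rw [pd, fderiv_apply_eq_pd, dotProduct_add, dotProduct_smul, dotProduct_smul]
  simp [← dU_eq_pd, ← dV_eq_pd, nrm_dot_dU, nrm_dot_dV]

/-- Differentiating `n · x_w' = 0`. -/
theorem pd_nrm_dot_pd (hx : AnalyticAt ℝ x q) (w w' : ℝ × ℝ) :
    pd w (nrm x) q ⬝ᵥ pd w' x q = -(nrm x q ⬝ᵥ pd w (pd w' x) q) := by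
  have h := pd_dot (w := w) (analyticAt_nrm hx) (analyticAt_pd (w := w') hx)
  have h0 : (fun p => nrm x p ⬝ᵥ pd w' x p) = fun _ => (0 : ℝ) :=
    funext fun p => nrm_dot_pd x p w'
  rw [h0, pd_const] at h
  linarith

theorem gaussCurvature_eq (hx : AnalyticAt ℝ x q) (hn : nrm x q ≠ 0) :
    gaussCurvature x q = disc x q / (nrm x q ⬝ᵥ nrm x q) ^ 2 := by
  have hpos := dot_self_pos hn
  have hN : ∀ a : E3, a ⬝ᵥ unitNormal x q =
      (Real.sqrt (nrm x q ⬝ᵥ nrm x q))⁻¹ * (nrm x q ⬝ᵥ a) := by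
    intro a
    rw [unitNormal, dotProduct_smul, dotProduct_comm (nrm x q) a]; rfl
  have huu := pd_nrm_dot_pd hx (1, 0) (1, 0)
  have huv := pd_nrm_dot_pd hx (1, 0) (0, 1)
  have hvu := pd_nrm_dot_pd hx (0, 1) (1, 0)
  have hvv := pd_nrm_dot_pd hx (0, 1) (0, 1)
  rw [pd_comm hx (1, 0) (0, 1)] at huv
  have hD : disc x q = (pd (1, 0) (nrm x) q ⬝ᵥ dU x q) * (pd (0, 1) (nrm x) q ⬝ᵥ dV x q)
      - (pd (1, 0) (nrm x) q ⬝ᵥ dV x q) * (pd (0, 1) (nrm x) q ⬝ᵥ dU x q) := by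
    rw [disc, triple, nrm, dotProduct_comm, cross_dot_cross]; rfl
  have hE : (dU x q ⬝ᵥ dU x q) * (dV x q ⬝ᵥ dV x q) - (dU x q ⬝ᵥ dV x q) ^ 2 =
      nrm x q ⬝ᵥ nrm x q := by
    rw [nrm, cross_dot_cross, dotProduct_comm (dV x q) (dU x q)]; ring
  have hs : (Real.sqrt (nrm x q ⬝ᵥ nrm x q))⁻¹ ^ 2 = (nrm x q ⬝ᵥ nrm x q)⁻¹ := by
    rw [inv_pow, Real.sq_sqrt hpos.le]
  rw [gaussCurvature, hE, hN, hN, hN, hD]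
  simp only [dU_eq_pd, dV_eq_pd] at *
  rw [huu, huv, hvu, hvv]
  generalize Real.sqrt (nrm x q ⬝ᵥ nrm x q) = r at *
  generalize nrm x q ⬝ᵥ nrm x q = m at *
  rw [div_eq_div_iff hpos.ne' (by positivity)]
  have : r⁻¹ ^ 2 * m = 1 := by rw [hs]; field_simp
  generalize r⁻¹ = i at *
  linear_combination (m * (nrm x q ⬝ᵥ pd (1, 0) (pd (1, 0) x) q *
    nrm x q ⬝ᵥ pd (0, 1) (pd (0, 1) x) q - (nrm x q ⬝ᵥ pd (0, 1) (pd (1, 0) x) q) ^ 2)) * this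

theorem gaussCurvature_ne_zero_iff (hx : AnalyticAt ℝ x q) (hn : nrm x q ≠ 0) :
    gaussCurvature x q ≠ 0 ↔ disc x q ≠ 0 := by
  rw [gaussCurvature_eq hx hn, div_ne_zero_iff]
  exact and_iff_left (pow_ne_zero _ (dot_self_pos hn).ne')

theorem nrm_ne_zero_of_disc (h : disc x q ≠ 0) : nrm x q ≠ 0 := by
  rintro h0
  exact h (by simp [disc, triple, h0])

theorem conormal_eq (hx : AnalyticAt ℝ x q) (hn : nrm x q ≠ 0) :
    conormal x q = |disc x q| ^ (-(1 / 4) : ℝ) • nrm x q := by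
  have hpos := dot_self_pos hn
  rw [conormal, gaussCurvature_eq hx hn, unitNormal, smul_smul]
  change (_ * (Real.sqrt (nrm x q ⬝ᵥ nrm x q))⁻¹) • nrm x q = _
  congr 1
  generalize nrm x q ⬝ᵥ nrm x q = m at *
  have hm : (m ^ 2) ^ (-(1 / 4) : ℝ) = (Real.sqrt m)⁻¹ := by
    rw [← Real.rpow_natCast, ← Real.rpow_mul hpos.le, Real.sqrt_eq_rpow, ← Real.rpow_neg hpos.le]
    norm_num
  rw [abs_div, abs_of_pos (pow_pos hpos 2), Real.div_rpow (abs_nonneg _) (by positivity), hm]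
  have := (Real.sqrt_pos.2 hpos).ne'
  field_simp

theorem pd_rpow_abs {D : ℝ × ℝ → ℝ} (hD : AnalyticAt ℝ D q) (h0 : D q ≠ 0) :
    DifferentiableAt ℝ (fun p => |D p| ^ (-(1 / 4) : ℝ)) q ∧ ∀ w,
      pd w (fun p => |D p| ^ (-(1 / 4) : ℝ)) q =
        -(1 / 4) * |D q| ^ (-(1 / 4) : ℝ) / D q * pd w D q := by
  have h1 := ((hasDerivAt_abs h0).comp_hasFDerivAt q hD.differentiableAt.hasFDerivAt).rpow_const
    (p := (-(1 / 4) : ℝ)) (Or.inl (abs_ne_zero.2 h0))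
  refine ⟨h1.differentiableAt, fun w => ?_⟩
  have h2 : pd w (fun p => |D p| ^ (-(1 / 4) : ℝ)) q = _ := DFunLike.congr_fun h1.fderiv w
  rw [h2]
  simp only [smul_apply, smul_eq_mul, Function.comp_apply]
  rw [Real.rpow_sub_one (abs_ne_zero.2 h0)]
  change _ * (_ * pd w D q) = _
  rcases lt_or_gt_of_ne h0 with h | h
  · rw [abs_of_neg h]; simp only [h, sign_neg, SignType.coe_neg, SignType.coe_one]; field_simp
  · rw [abs_of_pos h]; simp only [h, sign_pos, SignType.coe_one]; field_simp

/-- Where the curvature does not vanish, the affine normal is a nonzero multiple of `normalVec`. -/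
theorem exists_affineNormal_eq_smul (hx : AnalyticAt ℝ x q) (hD : disc x q ≠ 0) :
    ∃ c : ℝ, c ≠ 0 ∧ affineNormal x q = c • normalVec (nrm x) (disc x) q := by
  have hn := nrm_ne_zero_of_disc hD
  have hev : conormal x =ᶠ[𝓝 q] fun p => |disc x p| ^ (-(1 / 4) : ℝ) • nrm x p := by
    filter_upwards [hx.eventually_analyticAt,
      (analyticAt_nrm hx).continuousAt.eventually_ne hn] with p h1 h2
    exact conormal_eq h1 h2
  obtain ⟨hd, hpd⟩ := pd_rpow_abs (analyticAt_disc hx) hD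
  set r := |disc x q| ^ (-(1 / 4) : ℝ) with hr
  have hrpos : r ≠ 0 := (Real.rpow_pos_of_pos (abs_pos.2 hD) _).ne'
  have hpdν : ∀ w, pd w (conormal x) q =
      (-(1 / 4) * r / disc x q * pd w (disc x) q) • nrm x q + r • pd w (nrm x) q := by
    intro w
    rw [pd_congr hev, pd_smul hd (analyticAt_nrm hx), hpd w]
  have hT : triple (conormal x q) (dU (conormal x) q) (dV (conormal x) q) = r ^ 3 * disc x q := by
    rw [dU_eq_pd, dV_eq_pd, hpdν, hpdν, hev.self_of_nhds, disc]
    simp only [dU_eq_pd, dV_eq_pd, ← hr]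
    simp only [triple_eq, Pi.add_apply, Pi.smul_apply, smul_eq_mul]
    ring
  refine ⟨(r ^ 3 * disc x q)⁻¹ * (-(1 / 4) * r ^ 2 / disc x q), ?_, ?_⟩
  · have : (-(1 / 4) : ℝ) ≠ 0 := by norm_num
    positivity
  rw [affineNormal, hT, mul_smul]
  congr 1
  rw [dU_eq_pd, dV_eq_pd, hpdν, hpdν, normalVec]
  simp only [E3.ext_iff, cross_zero', cross_one', cross_two', Pi.add_apply, Pi.sub_apply,
    Pi.smul_apply, smul_eq_mul]
  refine ⟨?_, ?_, ?_⟩ <;> field_simp <;> ring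

end

theorem triple_smul_right (a b c : E3) (r : ℝ) : triple a b (r • c) = r * triple a b c := by
  simp only [triple_eq, Pi.smul_apply, smul_eq_mul]; ring

theorem cross_eq_zero {a b : E3} (hb : b ≠ 0) (h : a ⨯₃ b = 0) : ∃ c : ℝ, a = c • b := by
  refine ⟨(a ⬝ᵥ b) / (b ⬝ᵥ b), ?_⟩
  have hp := (dot_self_pos hb).ne'
  have h2 : (b ⬝ᵥ b) • a = (a ⬝ᵥ b) • b := by
    rw [E3.ext_iff] at h ⊢
    simp only [dot_eq, cross_zero', cross_one', cross_two', Pi.smul_apply, smul_eq_mul,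
      Pi.zero_apply] at h ⊢
    obtain ⟨h0, h1, h2⟩ := h
    refine ⟨?_, ?_, ?_⟩
    · linear_combination b 1 * h2 - b 2 * h1
    · linear_combination b 2 * h0 - b 0 * h2
    · linear_combination b 0 * h1 - b 1 * h0
  rw [div_eq_inv_mul, mul_smul, ← h2, smul_smul, inv_mul_cancel₀ hp, one_smul]

theorem exists_combination_of_triple_eq_zero {a b c : E3} (hab : a ⨯₃ b ≠ 0)
    (h : triple a b c = 0) : ∃ s t : ℝ, c = s • a + t • b := by
  have hp := (dot_self_pos hab).ne'
  refine ⟨(c ⨯₃ b) ⬝ᵥ (a ⨯₃ b) / ((a ⨯₃ b) ⬝ᵥ (a ⨯₃ b)),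
    (a ⨯₃ c) ⬝ᵥ (a ⨯₃ b) / ((a ⨯₃ b) ⬝ᵥ (a ⨯₃ b)), ?_⟩
  have key : ((a ⨯₃ b) ⬝ᵥ (a ⨯₃ b)) • c =
      ((c ⨯₃ b) ⬝ᵥ (a ⨯₃ b)) • a + ((a ⨯₃ c) ⬝ᵥ (a ⨯₃ b)) • b := by
    have : ((a ⨯₃ b) ⬝ᵥ (a ⨯₃ b)) • c = ((c ⨯₃ b) ⬝ᵥ (a ⨯₃ b)) • a +
        ((a ⨯₃ c) ⬝ᵥ (a ⨯₃ b)) • b + triple a b c • (a ⨯₃ b) := by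
      simp only [E3.ext_iff, dot_eq, triple_eq, cross_zero', cross_one', cross_two', Pi.smul_apply,
        smul_eq_mul, Pi.add_apply]
      refine ⟨?_, ?_, ?_⟩ <;> ring
    rw [this, h, zero_smul, add_zero]
  have h2 := congrArg (fun z => ((a ⨯₃ b) ⬝ᵥ (a ⨯₃ b))⁻¹ • z) key
  simp only [smul_add, smul_smul, inv_mul_cancel₀ hp, one_smul] at h2
  rw [div_eq_inv_mul, div_eq_inv_mul]
  exact h2

theorem mem_line_iff {a e p : E3} :
    p ∈ AffineSubspace.mk' a (Submodule.span ℝ {e}) ↔ ∃ c : ℝ, p - a = c • e := by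
  rw [AffineSubspace.mem_mk', vsub_eq_sub, Submodule.mem_span_singleton]
  simp only [eq_comm]

theorem meetsLine_iff {a e : E3} (he : e ≠ 0) (p w : E3) :
    MeetsLine p w (AffineSubspace.mk' a (Submodule.span ℝ {e})) ↔ triple (p - a) e w = 0 := by
  rw [MeetsLine, AffineSubspace.direction_mk', Submodule.mem_span_singleton]
  simp only [mem_line_iff]
  constructor
  · rintro (⟨c, d, h⟩ | ⟨c, rfl⟩)
    · have : p - a = d • e - c • w := by rw [← h]; abel
      rw [this]; simp only [triple_eq, Pi.smul_apply, Pi.sub_apply, smul_eq_mul]; ring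
    · simp only [triple_eq, Pi.smul_apply, Pi.sub_apply, smul_eq_mul]; ring
  · intro h
    by_cases h0 : (p - a) ⨯₃ e = 0
    · obtain ⟨c, hc⟩ := cross_eq_zero he h0
      exact Or.inl ⟨0, c, by rw [zero_smul, add_zero, hc]⟩
    · obtain ⟨s, t, hst⟩ := exists_combination_of_triple_eq_zero h0 h
      by_cases hs : s = 0
      · right; exact ⟨t, by rw [hst, hs, zero_smul, zero_add]⟩
      · left
        refine ⟨-s⁻¹, -s⁻¹ * t, ?_⟩
        rw [hst, smul_add, smul_smul, smul_smul, neg_mul, inv_mul_cancel₀ hs, neg_one_smul]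
        abel

/-- The affine normal line meets the line through `a` in the direction `e`, in terms of
`normalVec`. -/
theorem meetsLine_affineNormal_iff {x : ℝ × ℝ → E3} {q : ℝ × ℝ} (hx : AnalyticAt ℝ x q)
    (hD : disc x q ≠ 0) {a e : E3} (he : e ≠ 0) :
    MeetsLine (x q) (affineNormal x q) (AffineSubspace.mk' a (Submodule.span ℝ {e})) ↔
      triple (x q - a) e (normalVec (nrm x) (disc x) q) = 0 := by
  obtain ⟨c, hc, h⟩ := exists_affineNormal_eq_smul hx hD
  rw [meetsLine_iff he, h, triple_smul_right, mul_eq_zero, or_iff_right hc]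

theorem mem_tangentPlane_iff {x : ℝ × ℝ → E3} {q : ℝ × ℝ} (hn : nrm x q ≠ 0) (v : E3) :
    v ∈ tangentPlane x q ↔ nrm x q ⬝ᵥ v = 0 := by
  rw [tangentPlane, Submodule.mem_span_pair]
  constructor
  · rintro ⟨s, t, rfl⟩
    rw [dotProduct_add, dotProduct_smul, dotProduct_smul, nrm_dot_dU, nrm_dot_dV]; simp
  · intro h
    obtain ⟨s, t, hst⟩ := exists_combination_of_triple_eq_zero (c := v) hn (by
      rw [triple, triple_product_permutation, triple_product_permutation, dotProduct_comm]
      exact h)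
    exact ⟨s, t, hst.symm⟩

/-! ### Surfaces tangent to an infinitesimal affine rotation -/

theorem cross_mulVec_add (M : Matrix (Fin 3) (Fin 3) ℝ) (b c : E3) :
    (M *ᵥ b) ⨯₃ c + b ⨯₃ (M *ᵥ c) = M.trace • (b ⨯₃ c) - Mᵀ *ᵥ (b ⨯₃ c) := by
  simp only [E3.ext_iff, cross_zero', cross_one', cross_two', Pi.add_apply, Pi.sub_apply,
    Pi.smul_apply, smul_eq_mul, Matrix.mulVec, dot_eq, Matrix.trace, Matrix.diag,
    Fin.sum_univ_three, Matrix.transpose_apply]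
  refine ⟨?_, ?_, ?_⟩ <;> ring

theorem triple_mulVec_add (M : Matrix (Fin 3) (Fin 3) ℝ) (a b c : E3) :
    triple (M *ᵥ a) b c + triple a (M *ᵥ b) c + triple a b (M *ᵥ c) = M.trace * triple a b c := by
  simp only [triple_eq, Matrix.mulVec, dot_eq, Matrix.trace, Matrix.diag, Fin.sum_univ_three]
  ring

theorem transpose_mulVec_dot (M : Matrix (Fin 3) (Fin 3) ℝ) (n v : E3) :
    (Mᵀ *ᵥ n) ⬝ᵥ v = n ⬝ᵥ (M *ᵥ v) := by
  simp only [Matrix.mulVec, dot_eq, Matrix.transpose_apply]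
  ring

theorem triple_eq_zero_of_dot {m a b c : E3} (hm : m ≠ 0) (ha : m ⬝ᵥ a = 0) (hb : m ⬝ᵥ b = 0)
    (hc : m ⬝ᵥ c = 0) : triple a b c = 0 := by
  have key : triple a b c • m =
      (m ⬝ᵥ a) • (b ⨯₃ c) + (m ⬝ᵥ b) • (c ⨯₃ a) + (m ⬝ᵥ c) • (a ⨯₃ b) := by
    simp only [E3.ext_iff, dot_eq, triple_eq, cross_zero', cross_one', cross_two', Pi.smul_apply,
      smul_eq_mul, Pi.add_apply]
    refine ⟨?_, ?_, ?_⟩ <;> ring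
  rw [ha, hb, hc] at key
  simp only [zero_smul, add_zero] at key
  exact (smul_eq_zero.1 key).resolve_right hm

section

variable {x : ℝ × ℝ → E3} {q : ℝ × ℝ} {M : Matrix (Fin 3) (Fin 3) ℝ} {a : E3}

/-- The coefficients of a field of tangent vectors, here the velocities of the linear vector field
`p ↦ M (p - a)`, with respect to the basis `x_u`, `x_v`. -/
theorem exists_tangent_coefficients (hx : AnalyticAt ℝ x q) (hn : nrm x q ≠ 0)
    (ht : ∀ᶠ p in 𝓝 q, nrm x p ⬝ᵥ (M *ᵥ (x p - a)) = 0) :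
    ∃ α β : ℝ × ℝ → ℝ, AnalyticAt ℝ α q ∧ AnalyticAt ℝ β q ∧
      ∀ᶠ p in 𝓝 q, M *ᵥ (x p - a) = α p • pd (1, 0) x p + β p • pd (0, 1) x p := by
  have hw : AnalyticAt ℝ (fun p => M *ᵥ (x p - a)) q :=
    analyticAt_mulVec M (hx.sub analyticAt_const)
  have hN := analyticAt_nrm hx
  refine ⟨fun p => (((M *ᵥ (x p - a)) ⨯₃ pd (0, 1) x p) ⬝ᵥ nrm x p) / (nrm x p ⬝ᵥ nrm x p),
    fun p => ((pd (1, 0) x p ⨯₃ (M *ᵥ (x p - a))) ⬝ᵥ nrm x p) / (nrm x p ⬝ᵥ nrm x p),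
    (analyticAt_dot (analyticAt_cross hw (analyticAt_pd hx)) hN).div (analyticAt_dot hN hN)
      (dot_self_pos hn).ne',
    (analyticAt_dot (analyticAt_cross (analyticAt_pd hx) hw) hN).div (analyticAt_dot hN hN)
      (dot_self_pos hn).ne', ?_⟩
  filter_upwards [ht, hN.continuousAt.eventually_ne hn] with p h1 h2
  have hp := (dot_self_pos h2).ne'
  have key : (nrm x p ⬝ᵥ nrm x p) • (M *ᵥ (x p - a)) =
      (((M *ᵥ (x p - a)) ⨯₃ pd (0, 1) x p) ⬝ᵥ nrm x p) • pd (1, 0) x p +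
        ((pd (1, 0) x p ⨯₃ (M *ᵥ (x p - a))) ⬝ᵥ nrm x p) • pd (0, 1) x p := by
    have h3 : ∀ b c w : E3, ((b ⨯₃ c) ⬝ᵥ (b ⨯₃ c)) • w = ((w ⨯₃ c) ⬝ᵥ (b ⨯₃ c)) • b +
        ((b ⨯₃ w) ⬝ᵥ (b ⨯₃ c)) • c + ((b ⨯₃ c) ⬝ᵥ w) • (b ⨯₃ c) := by
      intro b c w
      simp only [E3.ext_iff, dot_eq, cross_zero', cross_one', cross_two', Pi.smul_apply,
        smul_eq_mul, Pi.add_apply]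
      refine ⟨?_, ?_, ?_⟩ <;> ring
    have h4 := h3 (pd (1, 0) x p) (pd (0, 1) x p) (M *ᵥ (x p - a))
    rw [← dU_eq_pd, ← dV_eq_pd] at h4 ⊢
    rw [← nrm, h1, zero_smul, add_zero] at h4
    exact h4
  have h5 := congrArg (fun z => (nrm x p ⬝ᵥ nrm x p)⁻¹ • z) key
  simp only [smul_add, smul_smul, inv_mul_cancel₀ hp, one_smul] at h5
  rw [div_eq_inv_mul, div_eq_inv_mul]
  exact h5

/-- Derivative of the normal field along the tangent field `α ∂_u + β ∂_v`, the restriction of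
the linear vector field `p ↦ M (p - a)` to the surface. -/
theorem pd_nrm_of_tangent (hM : M.trace = 0) (hx : AnalyticAt ℝ x q) {α β : ℝ × ℝ → ℝ}
    (hα : AnalyticAt ℝ α q) (hβ : AnalyticAt ℝ β q)
    (h : ∀ᶠ p in 𝓝 q, M *ᵥ (x p - a) = α p • pd (1, 0) x p + β p • pd (0, 1) x p) :
    α q • pd (1, 0) (nrm x) q + β q • pd (0, 1) (nrm x) q =
      -(Mᵀ *ᵥ nrm x q) - (pd (1, 0) α q + pd (0, 1) β q) • nrm x q := by
  have hxu : AnalyticAt ℝ (pd (1, 0) x) q := analyticAt_pd hx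
  have hxv : AnalyticAt ℝ (pd (0, 1) x) q := analyticAt_pd hx
  have hd : ∀ w, M *ᵥ pd w x q = pd w α q • pd (1, 0) x q + α q • pd w (pd (1, 0) x) q +
      (pd w β q • pd (0, 1) x q + β q • pd w (pd (0, 1) x) q) := by
    intro w
    rw [← pd_smul hα.differentiableAt hxu, ← pd_smul hβ.differentiableAt hxv,
      ← pd_add (f := fun p => α p • pd (1, 0) x p) (g := fun p => β p • pd (0, 1) x p)
        (hα.smul hxu) (hβ.smul hxv), ← pd_congr h,
      pd_mulVec (f := fun p => x p - a) M (hx.sub analyticAt_const), pd_sub_const]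
  have hu := hd (1, 0)
  have hv := hd (0, 1)
  have hnd : ∀ w, pd w (nrm x) q =
      pd w (pd (1, 0) x) q ⨯₃ pd (0, 1) x q + pd (1, 0) x q ⨯₃ pd w (pd (0, 1) x) q :=
    fun w => pd_cross hxu hxv
  rw [hnd, hnd]
  have hc := cross_mulVec_add M (pd (1, 0) x q) (pd (0, 1) x q)
  rw [hM, zero_smul, zero_sub, hu, hv] at hc
  have huv := pd_comm hx (1, 0) (0, 1)
  rw [huv] at hc ⊢
  change _ = -(Mᵀ *ᵥ (pd (1, 0) x q ⨯₃ pd (0, 1) x q)) - _ • (pd (1, 0) x q ⨯₃ pd (0, 1) x q)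
  rw [← hc]
  simp only [E3.ext_iff, cross_zero', cross_one', cross_two', Pi.smul_apply,
      smul_eq_mul, Pi.add_apply, Pi.sub_apply]
  refine ⟨?_, ?_, ?_⟩ <;> ring

/-- The determinant `[n, n_u, n_v]` has weight four along the tangent field. -/
theorem pd_disc_of_tangent (hM : M.trace = 0) (hx : AnalyticAt ℝ x q) {α β : ℝ × ℝ → ℝ}
    (hα : AnalyticAt ℝ α q) (hβ : AnalyticAt ℝ β q)
    (h : ∀ᶠ p in 𝓝 q, M *ᵥ (x p - a) = α p • pd (1, 0) x p + β p • pd (0, 1) x p) :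
    α q * pd (1, 0) (disc x) q + β q * pd (0, 1) (disc x) q =
      -(4 * (pd (1, 0) α q + pd (0, 1) β q)) * disc x q := by
  have hN := analyticAt_nrm hx
  have hNu : AnalyticAt ℝ (pd (1, 0) (nrm x)) q := analyticAt_pd hN
  have hNv : AnalyticAt ℝ (pd (0, 1) (nrm x)) q := analyticAt_pd hN
  have hev : (fun p => α p • pd (1, 0) (nrm x) p + β p • pd (0, 1) (nrm x) p) =ᶠ[𝓝 q]
      fun p => -Mᵀ *ᵥ nrm x p - (pd (1, 0) α p + pd (0, 1) β p) • nrm x p := by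
    filter_upwards [h.eventually_nhds, hα.eventually_analyticAt, hβ.eventually_analyticAt,
      hx.eventually_analyticAt] with p h1 h2 h3 h4
    rw [Matrix.neg_mulVec]
    exact pd_nrm_of_tangent hM h4 h2 h3 h1
  have hδ : AnalyticAt ℝ (fun p => pd (1, 0) α p + pd (0, 1) β p) q :=
    (analyticAt_pd hα).add (analyticAt_pd hβ)
  have hd : ∀ w, pd w α q • pd (1, 0) (nrm x) q + α q • pd w (pd (1, 0) (nrm x)) q +
      (pd w β q • pd (0, 1) (nrm x) q + β q • pd w (pd (0, 1) (nrm x)) q) =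
      -Mᵀ *ᵥ pd w (nrm x) q - (pd w (fun p => pd (1, 0) α p + pd (0, 1) β p) q • nrm x q +
        (pd (1, 0) α q + pd (0, 1) β q) • pd w (nrm x) q) := by
    intro w
    rw [← pd_smul hα.differentiableAt hNu, ← pd_smul hβ.differentiableAt hNv,
      ← pd_add (f := fun p => α p • pd (1, 0) (nrm x) p)
        (g := fun p => β p • pd (0, 1) (nrm x) p) (hα.smul hNu) (hβ.smul hNv), pd_congr hev,
      pd_sub (g := fun p => (pd (1, 0) α p + pd (0, 1) β p) • nrm x p)
        (analyticAt_mulVec _ hN) (hδ.smul hN), pd_mulVec _ hN, pd_smul hδ.differentiableAt hN]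
  have hu := hd (1, 0)
  have hv := hd (0, 1)
  have h0 := hev.self_of_nhds
  simp only at h0
  have huv := pd_comm hN (1, 0) (0, 1)
  rw [huv] at hu
  have hDd : ∀ w, pd w (disc x) q = triple (pd w (nrm x) q) (pd (1, 0) (nrm x) q)
      (pd (0, 1) (nrm x) q) + triple (nrm x q) (pd w (pd (1, 0) (nrm x)) q) (pd (0, 1) (nrm x) q)
      + triple (nrm x q) (pd (1, 0) (nrm x) q) (pd w (pd (0, 1) (nrm x)) q) :=
    fun w => pd_triple hN hNu hNv
  rw [hDd, hDd, huv]
  change _ = _ * triple (nrm x q) (pd (1, 0) (nrm x) q) (pd (0, 1) (nrm x) q)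
  have ht := triple_mulVec_add (-Mᵀ) (nrm x q) (pd (1, 0) (nrm x) q) (pd (0, 1) (nrm x) q)
  rw [Matrix.trace_neg, Matrix.trace_transpose, hM, neg_zero, zero_mul,
    sub_eq_iff_eq_add.1 h0.symm, sub_eq_iff_eq_add.1 hu.symm,
    sub_eq_iff_eq_add.1 hv.symm] at ht
  simp only [triple_eq, Pi.smul_apply, smul_eq_mul, Pi.add_apply] at ht ⊢
  linear_combination ht

/-- A surface tangent to an infinitesimal affine rotation has affine normals meeting the axis:
both `x - a` and the axis, and also the affine normal, are annihilated by the covector `Mᵀ n`. -/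
theorem triple_normalVec_of_tangent (hM : M.trace = 0) {e : E3} (he : M *ᵥ e = 0)
    (hker : ∀ w, M *ᵥ w = 0 → ∃ c : ℝ, w = c • e) (hx : AnalyticAt ℝ x q)
    (hD : disc x q ≠ 0) (ht : ∀ᶠ p in 𝓝 q, nrm x p ⬝ᵥ (M *ᵥ (x p - a)) = 0) :
    triple (x q - a) e (normalVec (nrm x) (disc x) q) = 0 := by
  obtain ⟨α, β, hα, hβ, h⟩ := exists_tangent_coefficients hx (nrm_ne_zero_of_disc hD) ht
  have h1 := pd_nrm_of_tangent hM hx hα hβ h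
  have h2 := pd_disc_of_tangent hM hx hα hβ h
  set δ := pd (1, 0) α q + pd (0, 1) β q
  have hV : (Mᵀ *ᵥ nrm x q) ⬝ᵥ normalVec (nrm x) (disc x) q = 0 := by
    have h3 : Mᵀ *ᵥ nrm x q =
        -(α q • pd (1, 0) (nrm x) q + β q • pd (0, 1) (nrm x) q + δ • nrm x q) := by
      rw [h1]; abel
    have hT : disc x q = triple (nrm x q) (pd (1, 0) (nrm x) q) (pd (0, 1) (nrm x) q) := rfl
    rw [h3, normalVec]
    generalize pd (1, 0) (disc x) q = Du at *
    generalize pd (0, 1) (disc x) q = Dv at *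
    simp only [triple_eq, dot_eq, cross_zero', cross_one', cross_two', Pi.smul_apply,
      Pi.neg_apply, Pi.sub_apply, smul_eq_mul, Pi.add_apply] at hT ⊢
    linear_combination (disc x q) * h2 + (-(α q * Du + β q * Dv) - 4 * disc x q * δ) * hT
  by_cases h0 : Mᵀ *ᵥ nrm x q = 0
  · have hn : α q • pd (1, 0) (nrm x) q + β q • pd (0, 1) (nrm x) q + δ • nrm x q = 0 := by
      rw [h1, h0]; simp
    have hα0 : α q * disc x q = 0 := by
      have : triple (nrm x q) (α q • pd (1, 0) (nrm x) q + β q • pd (0, 1) (nrm x) q +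
          δ • nrm x q) (pd (0, 1) (nrm x) q) = α q * disc x q := by
        simp only [disc, dU_eq_pd, dV_eq_pd, triple_eq, Pi.smul_apply, smul_eq_mul, Pi.add_apply]
        ring
      rw [← this, hn]; simp [triple_eq]
    have hβ0 : β q * disc x q = 0 := by
      have : triple (nrm x q) (pd (1, 0) (nrm x) q) (α q • pd (1, 0) (nrm x) q +
          β q • pd (0, 1) (nrm x) q + δ • nrm x q) = β q * disc x q := by
        simp only [disc, dU_eq_pd, dV_eq_pd, triple_eq, Pi.smul_apply, smul_eq_mul, Pi.add_apply]
        ring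
      rw [← this, hn]; simp [triple_eq]
    have hw := h.self_of_nhds
    rw [(mul_eq_zero.1 hα0).resolve_right hD, (mul_eq_zero.1 hβ0).resolve_right hD, zero_smul,
      zero_smul, add_zero] at hw
    obtain ⟨c, hc⟩ := hker _ hw
    rw [hc]
    simp only [triple_eq, Pi.smul_apply, smul_eq_mul]
    ring
  · refine triple_eq_zero_of_dot h0 ?_ ?_ hV
    · rw [transpose_mulVec_dot]; exact ht.self_of_nhds
    · rw [transpose_mulVec_dot, he, dotProduct_zero]

/-- A surface whose tangent planes all contain a fixed direction is developable. -/
theorem disc_eq_zero_of_dot {b : E3} (hb : b ≠ 0) (hx : AnalyticAt ℝ x q)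
    (h : ∀ᶠ p in 𝓝 q, nrm x p ⬝ᵥ b = 0) : disc x q = 0 := by
  have hN := analyticAt_nrm hx
  have hd : ∀ w, b ⬝ᵥ pd w (nrm x) q = 0 := by
    intro w
    have := pd_dot (w := w) (g := fun _ => b) hN analyticAt_const
    rw [pd_congr (g := fun _ => (0 : ℝ)) h, pd_const, pd_const, dotProduct_zero, add_zero] at this
    rw [dotProduct_comm, ← this]
  exact triple_eq_zero_of_dot hb (by rw [dotProduct_comm]; exact h.self_of_nhds) (hd _) (hd _)

/-- If a surface with nonvanishing curvature is tangent to a nonzero linear vector field that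
vanishes on the axis, then the field vanishes nowhere else: for `M` of rank one, the surface would
lie in a plane or its tangent planes would contain the fixed direction of the range of `M`. -/
theorem ker_of_tangent {e : E3} (he0 : e ≠ 0) (he : M *ᵥ e = 0) (hM0 : M ≠ 0)
    (hx : AnalyticAt ℝ x q) (hD : disc x q ≠ 0)
    (ht : ∀ᶠ p in 𝓝 q, nrm x p ⬝ᵥ (M *ᵥ (x p - a)) = 0) (w : E3) (hw : M *ᵥ w = 0) :
    ∃ c : ℝ, w = c • e := by
  by_contra hcon
  have hg : w ⨯₃ e ≠ 0 := fun h => hcon (cross_eq_zero he0 h)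
  set g := w ⨯₃ e with hgdef
  have hgp := (dot_self_pos hg).ne'
  -- `M` has rank one: it factors through the linear form `v ↦ v · g`.
  have hMv : ∀ v : E3, (g ⬝ᵥ g) • (M *ᵥ v) = (v ⬝ᵥ g) • (M *ᵥ g) := by
    intro v
    obtain ⟨s, t, hst⟩ := exists_combination_of_triple_eq_zero (a := w) (b := e)
      (c := (g ⬝ᵥ g) • v - (v ⬝ᵥ g) • g) hg (by
        rw [triple, triple_product_permutation, triple_product_permutation, ← hgdef,
          sub_dotProduct, smul_dotProduct, smul_dotProduct]
        simp [mul_comm])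
    have := congrArg (fun z => M *ᵥ z) hst
    simp only [Matrix.mulVec_sub, Matrix.mulVec_add, Matrix.mulVec_smul, hw, he, smul_zero,
      add_zero] at this
    exact sub_eq_zero.1 this
  have hb : M *ᵥ g ≠ 0 := by
    intro hb
    apply hM0
    refine Matrix.ext_of_mulVec_single fun i => ?_
    have := hMv (Pi.single i 1)
    rw [hb, smul_zero] at this
    rw [(smul_eq_zero.1 this).resolve_left hgp, Matrix.zero_mulVec]
  set b := M *ᵥ g with hbdef
  have hN := analyticAt_nrm hx
  have hprod : ∀ᶠ p in 𝓝 q, ((x p - a) ⬝ᵥ g) * (nrm x p ⬝ᵥ b) = 0 := by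
    filter_upwards [ht] with p hp
    have := congrArg (fun z => nrm x p ⬝ᵥ z) (hMv (x p - a))
    simp only [dotProduct_smul, hp, smul_eq_mul, mul_zero] at this
    exact this.symm
  by_cases hf : ∀ᶠ p in 𝓝 q, (x p - a) ⬝ᵥ g = 0
  · -- the surface lies in a plane
    refine hD (disc_eq_zero_of_dot he0 hx ?_)
    filter_upwards [hf.eventually_nhds, hx.eventually_analyticAt] with p hp hxp
    have hd : ∀ v, g ⬝ᵥ pd v x p = 0 := by
      intro v
      have h3 := pd_dot (w := v) (f := fun p => x p - a) (g := fun _ => g)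
        (hxp.sub analyticAt_const) analyticAt_const
      rw [pd_congr (g := fun _ => (0 : ℝ)) hp, pd_const, pd_const, pd_sub_const, dotProduct_zero,
        add_zero] at h3
      rw [dotProduct_comm, ← h3]
    rw [dotProduct_comm, nrm]
    refine triple_eq_zero_of_dot hg ?_ (hd (1, 0)) (hd (0, 1))
    rw [hgdef, dotProduct_comm, dot_cross_self]
  · -- the tangent planes contain a fixed direction
    obtain ⟨p, hp, hxp, hDp, hev⟩ := (Filter.not_eventually.1 hf).and_eventually
      (hx.eventually_analyticAt.and (((analyticAt_disc hx).continuousAt.eventually_ne hD).and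
        hprod.eventually_nhds)) |>.exists
    refine hDp (disc_eq_zero_of_dot hb hxp ?_)
    have h1 : AnalyticAt ℝ (fun p => (x p - a) ⬝ᵥ g) p :=
      analyticAt_dot (hxp.sub analyticAt_const) analyticAt_const
    filter_upwards [hev, h1.continuousAt.eventually_ne hp] with p' h2 h3
    exact (mul_eq_zero.1 h2).resolve_left h3

end

/-! ### The differential equations of the shadow line property in meridian coordinates -/

theorem hasDerivAt_unique_of_eventuallyEq {f g : ℝ → ℝ} {f' g' t : ℝ} (hf : HasDerivAt f f' t)
    (hg : HasDerivAt g g' t) (h : ∀ᶠ s in 𝓝 t, f s = g s) : f' = g' :=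
  hf.unique (hg.congr_of_eventuallyEq h)

theorem eq_of_hasDerivAt_zero {l r : ℝ} {f : ℝ → ℝ} (h : ∀ t ∈ Set.Ioo l r, HasDerivAt f 0 t)
    {s t : ℝ} (hs : s ∈ Set.Ioo l r) (ht : t ∈ Set.Ioo l r) : f s = f t :=
  isOpen_Ioo.is_const_of_deriv_eq_zero isPreconnected_Ioo
    (fun x hx => (h x hx).differentiableAt.differentiableWithinAt)
    (fun x hx => (h x hx).deriv) hs ht

theorem exists_antiderivative {l r : ℝ} {f : ℝ → ℝ} (hf : ContinuousOn f (Set.Ioo l r)) :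
    ∃ F : ℝ → ℝ, ∀ t ∈ Set.Ioo l r, HasDerivAt F (f t) t := by
  rcases (Set.Ioo l r).eq_empty_or_nonempty with h | ⟨m, hm⟩
  · exact ⟨0, fun t ht => by simp [h] at ht⟩
  refine ⟨fun t => ∫ x in m..t, f x, fun t ht => ?_⟩
  have hsub : Set.uIcc m t ⊆ Set.Ioo l r := Set.ordConnected_Ioo.uIcc_subset hm ht
  exact intervalIntegral.integral_hasDerivAt_right (hf.mono hsub).intervalIntegrable
    (hf.stronglyMeasurableAtFilter isOpen_Ioo t ht)
    (hf.continuousAt (isOpen_Ioo.mem_nhds ht))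

/-- A direction field `(a, 1 + t a, c)` along the pencil of planes is, under the differential
equations below, a multiple of a linear field of trace zero.  The factor `k` is determined up to a
constant by the requirement that the divergence vanishes, that is, by `k' = -2 a k`. -/
theorem exists_linear_normalization {l r : ℝ} {a a₁ a₂ c c₁ c₂ : ℝ → ℝ}
    (ha : ∀ t ∈ Set.Ioo l r, HasDerivAt a (a₁ t) t)
    (ha₁ : ∀ t ∈ Set.Ioo l r, HasDerivAt a₁ (a₂ t) t)
    (hc : ∀ t ∈ Set.Ioo l r, HasDerivAt c (c₁ t) t)
    (hc₁ : ∀ t ∈ Set.Ioo l r, HasDerivAt c₁ (c₂ t) t)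
    (hB : ∀ t ∈ Set.Ioo l r, a₂ t - 2 * a t * a₁ t = 4 * a t * (a₁ t - a t ^ 2))
    (hA : ∀ t ∈ Set.Ioo l r, c₂ t - a₁ t * c t - a t * c₁ t =
      3 * a t * (c₁ t - a t * c t) + c t * (a₁ t - a t ^ 2)) :
    ∃ k₀ k₁ k₂ d₀ d₁ : ℝ, ∀ t ∈ Set.Ioo l r, k₀ + k₁ * t + k₂ * t ^ 2 ≠ 0 ∧
      k₁ / 2 + k₂ * t = -a t * (k₀ + k₁ * t + k₂ * t ^ 2) ∧
      (k₀ + k₁ * t + k₂ * t ^ 2) * c t = d₀ + d₁ * t := by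
  rcases (Set.Ioo l r).eq_empty_or_nonempty with h | ⟨m, hm⟩
  · exact ⟨0, 0, 0, 0, 0, fun t ht => by simp [h] at ht⟩
  obtain ⟨K, hK⟩ := exists_antiderivative (l := l) (r := r) (f := fun t => -2 * a t)
    fun t ht => ((ha t ht).continuousAt.const_mul (-2)).continuousWithinAt
  -- In terms of `k`, equation `hB` says that `k''' = 0`, and `hA` that `(k c)'' = 0`.
  set k : ℝ → ℝ := fun t => Real.exp (K t) with hk
  have hkd : ∀ t ∈ Set.Ioo l r, HasDerivAt k (-2 * a t * k t) t := fun t ht =>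
    ((hK t ht).exp).congr_deriv (mul_comm _ _)
  have hk2 : ∀ t ∈ Set.Ioo l r,
      HasDerivAt (fun t => -2 * a t * k t) ((4 * a t ^ 2 - 2 * a₁ t) * k t) t := fun t ht =>
    (((ha t ht).const_mul (-2)).mul (hkd t ht)).congr_deriv (by ring)
  have hk3 : ∀ t ∈ Set.Ioo l r, HasDerivAt (fun t => (4 * a t ^ 2 - 2 * a₁ t) * k t) 0 t :=
    fun t ht => (((((ha t ht).pow 2).const_mul 4).sub ((ha₁ t ht).const_mul 2)).mul
      (hkd t ht)).congr_deriv (by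
        simp only [Pi.sub_apply, Pi.pow_apply, Nat.cast_ofNat, pow_one, Nat.add_one_sub_one]
        linear_combination (-2 * k t) * hB t ht)
  set k₂ := (4 * a m ^ 2 - 2 * a₁ m) * k m / 2 with hk₂
  have e2 : ∀ t ∈ Set.Ioo l r, (4 * a t ^ 2 - 2 * a₁ t) * k t = 2 * k₂ := by
    intro t ht
    have := eq_of_hasDerivAt_zero hk3 ht hm
    rw [this, hk₂]; ring
  have h1 : ∀ t ∈ Set.Ioo l r, HasDerivAt (fun t => -2 * a t * k t - 2 * k₂ * t) 0 t :=
    fun t ht => ((hk2 t ht).sub ((hasDerivAt_id t).const_mul (2 * k₂))).congr_deriv (by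
      rw [e2 t ht]; ring)
  set k₁ := -2 * a m * k m - 2 * k₂ * m with hk₁
  have e1 : ∀ t ∈ Set.Ioo l r, -2 * a t * k t = k₁ + 2 * k₂ * t := by
    intro t ht
    have := eq_of_hasDerivAt_zero h1 ht hm
    rw [hk₁, ← this]; ring
  have h0 : ∀ t ∈ Set.Ioo l r, HasDerivAt (fun t => k t - (k₁ * t + k₂ * t ^ 2)) 0 t :=
    fun t ht => ((hkd t ht).sub (((hasDerivAt_id t).const_mul k₁).add
      (((hasDerivAt_id t).pow 2).const_mul k₂))).congr_deriv (by
      rw [e1 t ht]; simp; ring)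
  set k₀ := k m - (k₁ * m + k₂ * m ^ 2) with hk₀
  have e0 : ∀ t ∈ Set.Ioo l r, k₀ + k₁ * t + k₂ * t ^ 2 = k t := by
    intro t ht
    have := eq_of_hasDerivAt_zero h0 ht hm
    rw [hk₀, ← this]; ring
  have g1 : ∀ t ∈ Set.Ioo l r,
      HasDerivAt (fun t => k t * c t) (k t * (c₁ t - 2 * a t * c t)) t := fun t ht =>
    ((hkd t ht).mul (hc t ht)).congr_deriv (by ring)
  have g2 : ∀ t ∈ Set.Ioo l r, HasDerivAt (fun t => k t * (c₁ t - 2 * a t * c t)) 0 t :=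
    fun t ht => ((hkd t ht).mul ((hc₁ t ht).sub (((ha t ht).const_mul 2).mul
      (hc t ht)))).congr_deriv (by
        simp only [Pi.sub_apply, Pi.mul_apply]
        linear_combination (k t) * hA t ht)
  set d₁ := k m * (c₁ m - 2 * a m * c m) with hd₁
  have f1 : ∀ t ∈ Set.Ioo l r, k t * (c₁ t - 2 * a t * c t) = d₁ := fun t ht =>
    eq_of_hasDerivAt_zero g2 ht hm
  have g0 : ∀ t ∈ Set.Ioo l r, HasDerivAt (fun t => k t * c t - d₁ * t) 0 t :=
    fun t ht => ((g1 t ht).sub ((hasDerivAt_id t).const_mul d₁)).congr_deriv (by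
      rw [f1 t ht]; ring)
  refine ⟨k₀, k₁, k₂, k m * c m - d₁ * m, d₁, fun t ht => ?_⟩
  have := eq_of_hasDerivAt_zero g0 ht hm
  rw [e0 t ht]
  refine ⟨(Real.exp_pos _).ne', ?_, ?_⟩
  · linear_combination -(1 / 2) * e1 t ht
  · rw [← this]; ring

section

variable {z D : ℝ × ℝ → ℝ} {I J : Set ℝ}

/-- Not all meridians are straight: `hD` says that `D` is the determinant of the second fundamental
form, `hN` that the affine normals meet the axis, and for `z_ss = 0` the two give
`D = -(s z_st - z_t)²` and `D (s z_st - z_t) = 0`. -/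
theorem not_straight_meridians (hI : IsOpen I) (hJ : IsOpen J) (hI0 : ∀ s ∈ I, s ≠ 0)
    (hz : ∀ p ∈ I ×ˢ J, AnalyticAt ℝ z p)
    (hD : ∀ p ∈ I ×ˢ J, D p = p.1 ^ 2 * pd (1, 0) (pd (1, 0) z) p * pd (0, 1) (pd (0, 1) z) p
      - (p.1 * pd (0, 1) (pd (1, 0) z) p - pd (0, 1) z p) ^ 2)
    (hD0 : ∀ p ∈ I ×ˢ J, D p ≠ 0)
    (hN : ∀ p ∈ I ×ˢ J, (p.1 * pd (1, 0) D p - 4 * D p) *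
      (p.1 * pd (0, 1) (pd (1, 0) z) p - pd (0, 1) z p) -
        p.1 ^ 2 * pd (1, 0) (pd (1, 0) z) p * pd (0, 1) D p = 0)
    {p : ℝ × ℝ} (hp : p ∈ I ×ˢ J) :
    ∃ p ∈ I ×ˢ J, pd (1, 0) (pd (1, 0) z) p ≠ 0 := by
  by_contra! hcon
  have hopen : IsOpen (I ×ˢ J) := hI.prod hJ
  have hev : ∀ᶠ p' in 𝓝 p, p' ∈ I ×ˢ J := hopen.mem_nhds hp
  have hz' := hz p hp
  have hP : AnalyticAt ℝ (pd (1, 0) z) p := analyticAt_pd hz'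
  have hQ : AnalyticAt ℝ (pd (0, 1) z) p := analyticAt_pd hz'
  have hPt : AnalyticAt ℝ (pd (0, 1) (pd (1, 0) z)) p := analyticAt_pd hP
  obtain ⟨s, t⟩ := p
  have hs : s ≠ 0 := hI0 s hp.1
  -- The function `s z_st - z_t` is constant along the meridian.
  have hg := ((hasDerivAt_id s).mul (hasDerivAt_fst hPt)).sub (hasDerivAt_fst hQ)
  have hPst : pd (1, 0) (pd (0, 1) (pd (1, 0) z)) (s, t) = 0 := by
    rw [pd_comm hP, pd_congr (g := fun _ => (0 : ℝ)) (hev.mono hcon), pd_const]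
  rw [hPst, pd_comm hz' (1, 0) (0, 1)] at hg
  have hDs : pd (1, 0) D (s, t) = 0 := by
    have hDev : D =ᶠ[𝓝 (s, t)] fun p =>
        p.1 ^ 2 * pd (1, 0) (pd (1, 0) z) p * pd (0, 1) (pd (0, 1) z) p
          - (p.1 * pd (0, 1) (pd (1, 0) z) p - pd (0, 1) z p) ^ 2 := hev.mono hD
    have hfst : AnalyticAt ℝ (fun p : ℝ × ℝ => p.1) (s, t) := analyticAt_fst
    have hDan : AnalyticAt ℝ D (s, t) := by
      refine AnalyticAt.congr ?_ hDev.symm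
      exact (((hfst.pow 2).mul (analyticAt_pd hP)).mul (analyticAt_pd hQ)).sub
        (((hfst.mul hPt).sub hQ).pow 2)
    refine hasDerivAt_unique_of_eventuallyEq (hasDerivAt_fst hDan)
      ((hg.pow 2).neg.congr_deriv ?_) ?_
    · simp
    · filter_upwards [hI.mem_nhds hp.1] with s' hs'
      have hp' : (s', t) ∈ I ×ˢ J := ⟨hs', hp.2⟩
      rw [hD _ hp', hcon _ hp']
      simp
  have h1 := hN _ hp
  rw [hDs, hcon _ hp] at h1
  have h2 := hD _ hp
  have h3 := hD0 _ hp
  rw [hcon _ hp] at h2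
  simp only at h1 h2
  have h4 : s * pd (0, 1) (pd (1, 0) z) (s, t) - pd (0, 1) z (s, t) = 0 := by
    refine (mul_eq_zero.1 ?_).resolve_left h3
    linear_combination (-1 / 4) * h1
  rw [h4] at h2
  exact h3 (by rw [h2]; ring)

/-- The shadow direction of the meridian plane with parameter `t` has, where the meridian is
curved, the coordinates `(a, 1 + t a, c)` up to scale. -/
theorem shadow_equation (hI : IsOpen I) {t : ℝ}
    (hz : ∀ s ∈ I, AnalyticAt ℝ z (s, t)) {v₁ v₂ v₃ : ℝ}
    (hv : v₁ ≠ 0 ∨ v₂ ≠ 0 ∨ v₃ ≠ 0)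
    (hS : ∀ s ∈ I, s * v₃ = (v₂ - t * v₁) * pd (0, 1) z (s, t) + s * v₁ * pd (1, 0) z (s, t))
    {s₀ : ℝ} (hs₀ : s₀ ∈ I) (hs0 : s₀ ≠ 0) (hP : pd (1, 0) (pd (1, 0) z) (s₀, t) ≠ 0) :
    ∃ α γ : ℝ,
      α = -(s₀ * pd (0, 1) (pd (1, 0) z) (s₀, t) - pd (0, 1) z (s₀, t)) /
          (s₀ ^ 2 * pd (1, 0) (pd (1, 0) z) (s₀, t)) ∧
      γ = α * pd (1, 0) z (s₀, t) + pd (0, 1) z (s₀, t) / s₀ ∧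
      ∀ s ∈ I, α * s * pd (1, 0) z (s, t) + pd (0, 1) z (s, t) = γ * s := by
  have hz₀ := hz s₀ hs₀
  have hPd := hasDerivAt_fst (analyticAt_pd (w := (1, 0)) hz₀)
  have hQd := hasDerivAt_fst (analyticAt_pd (w := (0, 1)) hz₀)
  rw [pd_comm hz₀ (1, 0) (0, 1)] at hQd
  have hd := hasDerivAt_unique_of_eventuallyEq ((hasDerivAt_id s₀).mul_const v₃)
    ((hQd.const_mul (v₂ - t * v₁)).add (((hasDerivAt_id s₀).mul_const v₁).mul hPd))
    (by filter_upwards [hI.mem_nhds hs₀] with s hs using hS s hs)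
  simp only [id, one_mul] at hd
  have h0 := hS s₀ hs₀
  have hb : v₂ - t * v₁ ≠ 0 := by
    intro hb
    rw [hb] at hd h0
    have h1 : v₁ = 0 := by
      have : v₁ * (s₀ * pd (1, 0) (pd (1, 0) z) (s₀, t)) * s₀ = 0 := by
        linear_combination h0 - s₀ * hd
      simpa [hs0, hP] using this
    have h3 : v₃ = 0 := by
      rw [h1] at h0
      simpa [hs0] using h0
    have h2 : v₂ = 0 := by rw [h1] at hb; simpa using hb
    simp [h1, h2, h3] at hv
  set b := v₂ - t * v₁
  have e1 : v₁ / b = -(s₀ * pd (0, 1) (pd (1, 0) z) (s₀, t) - pd (0, 1) z (s₀, t)) /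
          (s₀ ^ 2 * pd (1, 0) (pd (1, 0) z) (s₀, t)) := by
    rw [div_eq_div_iff hb (by positivity)]
    linear_combination h0 - s₀ * hd
  refine ⟨v₁ / b, v₃ / b, e1, ?_, ?_⟩
  · field_simp
    linear_combination h0
  · intro s hs
    have := hS s hs
    field_simp
    linear_combination -this

/-- In meridian coordinates, the two geometric conditions force the surface `z = z(s, t)` to be
tangent to a linear vector field of trace zero.  Here `hD`, `hN` and `hS` express the determinant of
the second fundamental form, the condition on the affine normals and the shadow line property. -/
theorem exists_linear_tangent_field (hI : IsOpen I) (hJ : IsOpen J) (hI0 : ∀ s ∈ I, s ≠ 0)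
    (hz : ∀ p ∈ I ×ˢ J, AnalyticAt ℝ z p)
    (hD : ∀ p ∈ I ×ˢ J, D p = p.1 ^ 2 * pd (1, 0) (pd (1, 0) z) p * pd (0, 1) (pd (0, 1) z) p
      - (p.1 * pd (0, 1) (pd (1, 0) z) p - pd (0, 1) z p) ^ 2)
    (hD0 : ∀ p ∈ I ×ˢ J, D p ≠ 0)
    (hN : ∀ p ∈ I ×ˢ J, (p.1 * pd (1, 0) D p - 4 * D p) *
      (p.1 * pd (0, 1) (pd (1, 0) z) p - pd (0, 1) z p) -
        p.1 ^ 2 * pd (1, 0) (pd (1, 0) z) p * pd (0, 1) D p = 0)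
    (hS : ∀ t ∈ J, ∃ v₁ v₂ v₃ : ℝ, (v₁ ≠ 0 ∨ v₂ ≠ 0 ∨ v₃ ≠ 0) ∧ ∀ s ∈ I,
      s * v₃ = (v₂ - t * v₁) * pd (0, 1) z (s, t) + s * v₁ * pd (1, 0) z (s, t))
    {p : ℝ × ℝ} (hp : p ∈ I ×ˢ J) :
    ∃ p ∈ I ×ˢ J, ∃ k₀ k₁ k₂ d₀ d₁ : ℝ, (k₀ ≠ 0 ∨ k₁ ≠ 0 ∨ k₂ ≠ 0) ∧ ∀ᶠ p' in 𝓝 p,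
      (k₀ + k₁ * p'.2 + k₂ * p'.2 ^ 2) * pd (0, 1) z p' -
        (k₁ / 2 + k₂ * p'.2) * (p'.1 * pd (1, 0) z p') = p'.1 * (d₀ + d₁ * p'.2) := by
  obtain ⟨⟨s₀, t₀⟩, hp₀, hP₀⟩ := not_straight_meridians hI hJ hI0 hz hD hD0 hN hp
  have hs0 := hI0 s₀ hp₀.1
  have hev : ∀ᶠ p' in 𝓝 (s₀, t₀), p' ∈ I ×ˢ J ∧ pd (1, 0) (pd (1, 0) z) p' ≠ 0 :=
    Filter.Eventually.and ((hI.prod hJ).mem_nhds hp₀)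
      ((analyticAt_pd (analyticAt_pd (hz _ hp₀))).continuousAt.eventually_ne hP₀)
  obtain ⟨r, hr, hball⟩ := Metric.eventually_nhds_iff_ball.1 hev
  set I' := Set.Ioo (s₀ - r) (s₀ + r) with hI'
  set J' := Set.Ioo (t₀ - r) (t₀ + r) with hJ'
  have hbox : ∀ s ∈ I', ∀ t ∈ J', (s, t) ∈ I ×ˢ J ∧ pd (1, 0) (pd (1, 0) z) (s, t) ≠ 0 := by
    intro s hs t ht
    refine hball _ ?_
    rw [← ball_prod_same, Real.ball_eq_Ioo, Real.ball_eq_Ioo]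
    exact ⟨hs, ht⟩
  have hs₀' : s₀ ∈ I' := ⟨by linarith, by linarith⟩
  have ht₀' : t₀ ∈ J' := ⟨by linarith, by linarith⟩
  have hI'o : IsOpen I' := isOpen_Ioo
  have hJ'o : IsOpen J' := isOpen_Ioo
  set a : ℝ → ℝ := fun t => -(s₀ * pd (0, 1) (pd (1, 0) z) (s₀, t) - pd (0, 1) z (s₀, t)) /
    (s₀ ^ 2 * pd (1, 0) (pd (1, 0) z) (s₀, t)) with ha
  set c : ℝ → ℝ := fun t => a t * pd (1, 0) z (s₀, t) + pd (0, 1) z (s₀, t) / s₀ with hc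
  have hE0 : ∀ s ∈ I', ∀ t ∈ J',
      a t * s * pd (1, 0) z (s, t) + pd (0, 1) z (s, t) = c t * s := by
    intro s hs t ht
    obtain ⟨v₁, v₂, v₃, hv, hS'⟩ := hS t (hbox s₀ hs₀' t ht).1.2
    obtain ⟨α, γ, hα, hγ, h⟩ := shadow_equation hI'o (fun s hs => hz _ (hbox s hs t ht).1) hv
      (fun s hs => hS' s (hbox s hs t ht).1.1) hs₀' hs0 (hbox s₀ hs₀' t ht).2
    have hα' : α = a t := hα
    rw [hα'] at hγ h
    have hγ' : γ = c t := hγ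
    rw [hγ'] at h
    exact h s hs
  have hcurve : ∀ (f : ℝ × ℝ → ℝ) (t : ℝ), AnalyticAt ℝ f (s₀, t) →
      AnalyticAt ℝ (fun t => f (s₀, t)) t := fun f t hf =>
    hf.comp (f := fun t => (s₀, t)) (analyticAt_const.prod analyticAt_id)
  have haan : ∀ t ∈ J', AnalyticAt ℝ a t := by
    intro t ht
    have hzt := hz _ (hbox s₀ hs₀' t ht).1
    refine AnalyticAt.div ?_ (analyticAt_const.mul (hcurve _ t (analyticAt_pd
      (analyticAt_pd hzt)))) (mul_ne_zero (pow_ne_zero 2 hs0) (hbox s₀ hs₀' t ht).2)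
    exact ((analyticAt_const.mul (hcurve _ t (analyticAt_pd (analyticAt_pd hzt)))).sub
      (hcurve _ t (analyticAt_pd hzt))).neg
  have hcan : ∀ t ∈ J', AnalyticAt ℝ c t := by
    intro t ht
    have hzt := hz _ (hbox s₀ hs₀' t ht).1
    exact ((haan t ht).mul (hcurve _ t (analyticAt_pd hzt))).add
      ((hcurve _ t (analyticAt_pd hzt)).div analyticAt_const hs0)
  have had : ∀ t ∈ J', HasDerivAt a (deriv a t) t := fun t ht =>
    (haan t ht).differentiableAt.hasDerivAt
  have had₁ : ∀ t ∈ J', HasDerivAt (deriv a) (deriv (deriv a) t) t := fun t ht =>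
    (haan t ht).deriv.differentiableAt.hasDerivAt
  have hcd : ∀ t ∈ J', HasDerivAt c (deriv c t) t := fun t ht =>
    (hcan t ht).differentiableAt.hasDerivAt
  have hcd₁ : ∀ t ∈ J', HasDerivAt (deriv c) (deriv (deriv c) t) t := fun t ht =>
    (hcan t ht).deriv.differentiableAt.hasDerivAt
  -- The shadow equation `a s z_s + z_t = c s` and its derivatives express all derivatives of `z`
  -- that occur through `z_s`, `z_ss` and `z_sss`.
  have hE1 : ∀ s ∈ I', ∀ t ∈ J', pd (0, 1) (pd (1, 0) z) (s, t) =
      c t - a t * pd (1, 0) z (s, t) - a t * s * pd (1, 0) (pd (1, 0) z) (s, t) := by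
    intro s hs t ht
    have hzt := hz _ (hbox s hs t ht).1
    have hQd := hasDerivAt_fst (analyticAt_pd (w := (0, 1)) hzt)
    rw [pd_comm hzt (1, 0) (0, 1)] at hQd
    have := hasDerivAt_unique_of_eventuallyEq
      ((((hasDerivAt_id s).const_mul (a t)).mul (hasDerivAt_fst (analyticAt_pd hzt))).add hQd)
      ((hasDerivAt_id s).const_mul (c t))
      (by filter_upwards [hI'o.mem_nhds hs] with s' hs' using hE0 s' hs' t ht)
    simp only [id] at this
    linear_combination this
  have hE2 : ∀ s ∈ I', ∀ t ∈ J', pd (0, 1) (pd (0, 1) z) (s, t) =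
      deriv c t * s - deriv a t * s * pd (1, 0) z (s, t) -
        a t * s * pd (0, 1) (pd (1, 0) z) (s, t) := by
    intro s hs t ht
    have hzt := hz _ (hbox s hs t ht).1
    have := hasDerivAt_unique_of_eventuallyEq
      ((((had t ht).mul_const s).mul (hasDerivAt_snd (analyticAt_pd (w := (1, 0)) hzt))).add
        (hasDerivAt_snd (analyticAt_pd (w := (0, 1)) hzt)))
      ((hcd t ht).mul_const s)
      (by filter_upwards [hJ'o.mem_nhds ht] with t' ht' using hE0 s hs t' ht')
    linear_combination this
  have hE1s : ∀ s ∈ I', ∀ t ∈ J', pd (0, 1) (pd (1, 0) (pd (1, 0) z)) (s, t) =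
      -2 * a t * pd (1, 0) (pd (1, 0) z) (s, t) -
        a t * s * pd (1, 0) (pd (1, 0) (pd (1, 0) z)) (s, t) := by
    intro s hs t ht
    have hzt := hz _ (hbox s hs t ht).1
    have hP : AnalyticAt ℝ (pd (1, 0) z) (s, t) := analyticAt_pd hzt
    have hd := hasDerivAt_fst (analyticAt_pd (w := (0, 1)) hP)
    rw [pd_comm hP (1, 0) (0, 1)] at hd
    have := hasDerivAt_unique_of_eventuallyEq hd
      (((hasDerivAt_const s (c t)).sub ((hasDerivAt_fst hP).const_mul (a t))).sub
        (((hasDerivAt_id s).const_mul (a t)).mul (hasDerivAt_fst (analyticAt_pd hP))))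
      (by filter_upwards [hI'o.mem_nhds hs] with s' hs' using hE1 s' hs' t ht)
    simp only [id] at this
    linear_combination this
  -- Consequently `D` is affine in `z_s`, up to the factor `s ^ 3 z_ss`.
  have hDE : ∀ s ∈ I', ∀ t ∈ J', D (s, t) = s ^ 3 * pd (1, 0) (pd (1, 0) z) (s, t) *
      ((deriv c t - a t * c t) - (deriv a t - a t ^ 2) * pd (1, 0) z (s, t)) := by
    intro s hs t ht
    have h0 := hE0 s hs t ht
    rw [hD _ (hbox s hs t ht).1]
    simp only
    rw [hE2 s hs t ht, hE1 s hs t ht, eq_sub_of_add_eq' h0]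
    ring
  have hDan : ∀ s ∈ I', ∀ t ∈ J', AnalyticAt ℝ D (s, t) := by
    intro s hs t ht
    have hzt := hz _ (hbox s hs t ht).1
    have hfst : AnalyticAt ℝ (fun p : ℝ × ℝ => p.1) (s, t) := analyticAt_fst
    refine AnalyticAt.congr ?_ (Filter.EventuallyEq.symm
      (Filter.Eventually.mono ((hI.prod hJ).mem_nhds (hbox s hs t ht).1) hD))
    exact (((hfst.pow 2).mul (analyticAt_pd (analyticAt_pd hzt))).mul (analyticAt_pd
      (analyticAt_pd hzt))).sub (((hfst.mul (analyticAt_pd (analyticAt_pd hzt))).sub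
        (analyticAt_pd hzt)).pow 2)
  -- The condition on the affine normals becomes an affine relation in `z_s` with coefficients that
  -- depend on `t` alone.  As `z_s` varies along a meridian, both coefficients vanish: this gives
  -- the ordinary differential equations `hB` and `hA` below.
  have hE3 : ∀ s ∈ I', ∀ t ∈ J',
      (deriv (deriv c) t - deriv a t * c t - a t * deriv c t) -
        3 * a t * (deriv c t - a t * c t) - c t * (deriv a t - a t ^ 2) =
      ((deriv (deriv a) t - 2 * a t * deriv a t) - 4 * a t * (deriv a t - a t ^ 2)) *
        pd (1, 0) z (s, t) := by
    intro s hs t ht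
    have hzt := hz _ (hbox s hs t ht).1
    have hP : AnalyticAt ℝ (pd (1, 0) z) (s, t) := analyticAt_pd hzt
    have hPs : AnalyticAt ℝ (pd (1, 0) (pd (1, 0) z)) (s, t) := analyticAt_pd hP
    have hDs := hasDerivAt_unique_of_eventuallyEq (hasDerivAt_fst (hDan s hs t ht))
      ((((hasDerivAt_id s).pow 3).mul (hasDerivAt_fst hPs)).mul
        ((hasDerivAt_const s (deriv c t - a t * c t)).sub
          ((hasDerivAt_fst hP).const_mul (deriv a t - a t ^ 2))))
      (by filter_upwards [hI'o.mem_nhds hs] with s' hs' using hDE s' hs' t ht)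
    have hDt := hasDerivAt_unique_of_eventuallyEq (hasDerivAt_snd (hDan s hs t ht))
      (((hasDerivAt_snd hPs).const_mul (s ^ 3)).mul
        (((hcd₁ t ht).sub ((had t ht).mul (hcd t ht))).sub
          (((had₁ t ht).sub ((had t ht).pow 2)).mul (hasDerivAt_snd hP))))
      (by filter_upwards [hJ'o.mem_nhds ht] with t' ht' using hDE s hs t' ht')
    simp only [id, Pi.pow_apply, Pi.sub_apply, Pi.mul_apply, Nat.cast_ofNat,
      Nat.add_one_sub_one, pow_one] at hDs hDt
    have h1 := hN _ (hbox s hs t ht).1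
    simp only at h1
    have hs' : s ≠ 0 := hI0 s (hbox s hs t ht).1.1
    have hPs0 := (hbox s hs t ht).2
    have h0 := hE0 s hs t ht
    rw [hDs, hDt, hDE s hs t ht, hE1s s hs t ht, hE1 s hs t ht, eq_sub_of_add_eq' h0] at h1
    have h2 : s ^ 5 * pd (1, 0) (pd (1, 0) z) (s, t) ^ 2 ≠ 0 := by positivity
    refine sub_eq_zero.1 ((mul_eq_zero.1 ?_).resolve_left h2)
    linear_combination -h1
  have hB : ∀ t ∈ J', deriv (deriv a) t - 2 * a t * deriv a t =
      4 * a t * (deriv a t - a t ^ 2) := by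
    intro t ht
    have hP : AnalyticAt ℝ (pd (1, 0) z) (s₀, t) := analyticAt_pd (hz _ (hbox s₀ hs₀' t ht).1)
    have := hasDerivAt_unique_of_eventuallyEq (hasDerivAt_const s₀ _)
      ((hasDerivAt_fst hP).const_mul _)
      (by filter_upwards [hI'o.mem_nhds hs₀'] with s' hs' using hE3 s' hs' t ht)
    exact sub_eq_zero.1 ((mul_eq_zero.1 this.symm).resolve_right (hbox s₀ hs₀' t ht).2)
  have hA : ∀ t ∈ J', deriv (deriv c) t - deriv a t * c t - a t * deriv c t =
      3 * a t * (deriv c t - a t * c t) + c t * (deriv a t - a t ^ 2) := by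
    intro t ht
    have := hE3 s₀ hs₀' t ht
    rw [hB t ht] at this
    linear_combination this
  obtain ⟨k₀, k₁, k₂, d₀, d₁, hk⟩ := exists_linear_normalization had had₁ hcd hcd₁ hB hA
  refine ⟨(s₀, t₀), hp₀, k₀, k₁, k₂, d₀, d₁, ?_, ?_⟩
  · have := (hk t₀ ht₀').1
    contrapose! this
    simp [this.1, this.2.1, this.2.2]
  · filter_upwards [(hI'o.prod hJ'o).mem_nhds (show (s₀, t₀) ∈ I' ×ˢ J' from ⟨hs₀', ht₀'⟩)]
      with p hp
    obtain ⟨s, t⟩ := p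
    obtain ⟨-, h1, h2⟩ := hk t hp.2
    have h0 := hE0 s hp.1 t hp.2
    simp only
    rw [h1, ← h2]
    linear_combination (k₀ + k₁ * t + k₂ * t ^ 2) * h0

end

/-! ### Change of parameters -/

theorem exists_local_inverse {Φ : ℝ × ℝ → ℝ × ℝ} {q₀ : ℝ × ℝ} (hΦ : AnalyticAt ℝ Φ q₀)
    (hinj : ∀ w, fderiv ℝ Φ q₀ w = 0 → w = 0) :
    ∃ ψ : ℝ × ℝ → ℝ × ℝ, AnalyticAt ℝ ψ (Φ q₀) ∧ ψ (Φ q₀) = q₀ ∧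
      (∀ᶠ p in 𝓝 (Φ q₀), Φ (ψ p) = p) ∧ ∀ᶠ q in 𝓝 q₀, ψ (Φ q) = q := by
  have hker : Function.Injective (fderiv ℝ Φ q₀ : ℝ × ℝ →ₗ[ℝ] ℝ × ℝ) :=
    (injective_iff_map_eq_zero _).2 hinj
  set E := (LinearEquiv.ofInjectiveEndo _ hker).toContinuousLinearEquiv with hE
  have hE' : (E : ℝ × ℝ →L[ℝ] ℝ × ℝ) = fderiv ℝ Φ q₀ := by ext <;> rfl
  have hd : HasFDerivAt Φ (E : ℝ × ℝ →L[ℝ] ℝ × ℝ) q₀ :=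
    hE' ▸ hΦ.differentiableAt.hasFDerivAt
  have hc : ContDiffAt ℝ ⊤ Φ q₀ := hΦ.contDiffAt
  have hs : HasStrictFDerivAt Φ (E : ℝ × ℝ →L[ℝ] ℝ × ℝ) q₀ :=
    hc.hasStrictFDerivAt' hd (by simp)
  exact ⟨hc.localInverse hd (by simp), (hc.to_localInverse hd (by simp)).analyticAt,
    hs.localInverse_apply_image, hs.eventually_right_inverse, hs.eventually_left_inverse⟩

section

variable {x : ℝ × ℝ → E3} {ψ : ℝ × ℝ → ℝ × ℝ} {p : ℝ × ℝ}

/-- The Jacobian determinant of a change of parameters. -/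
noncomputable def jac (ψ : ℝ × ℝ → ℝ × ℝ) (p : ℝ × ℝ) : ℝ :=
  (pd (1, 0) ψ p).1 * (pd (0, 1) ψ p).2 - (pd (1, 0) ψ p).2 * (pd (0, 1) ψ p).1

theorem analyticAt_jac (hψ : AnalyticAt ℝ ψ p) : AnalyticAt ℝ (jac ψ) p := by
  have h1 : ∀ w, AnalyticAt ℝ (pd w ψ) p := fun w => analyticAt_pd hψ
  exact ((analyticAt_fst.comp (h1 _)).mul (analyticAt_snd.comp (h1 _))).sub
    ((analyticAt_snd.comp (h1 _)).mul (analyticAt_fst.comp (h1 _)))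

theorem nrm_comp (hψ : AnalyticAt ℝ ψ p) (hx : AnalyticAt ℝ x (ψ p)) :
    nrm (fun p => x (ψ p)) p = jac ψ p • nrm x (ψ p) := by
  rw [nrm, dU_eq_pd, dV_eq_pd, pd_comp hψ hx, pd_comp hψ hx, nrm, dU_eq_pd, dV_eq_pd, jac]
  simp only [E3.ext_iff, cross_zero', cross_one', cross_two', Pi.add_apply,
    Pi.smul_apply, smul_eq_mul]
  refine ⟨?_, ?_, ?_⟩ <;> ring

theorem pd_nrm_comp (hψ : AnalyticAt ℝ ψ p) (hx : AnalyticAt ℝ x (ψ p)) (w : ℝ × ℝ) :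
    pd w (nrm fun p => x (ψ p)) p = pd w (jac ψ) p • nrm x (ψ p) + jac ψ p •
      ((pd w ψ p).1 • pd (1, 0) (nrm x) (ψ p) + (pd w ψ p).2 • pd (0, 1) (nrm x) (ψ p)) := by
  have hev : (nrm fun p => x (ψ p)) =ᶠ[𝓝 p] fun p => jac ψ p • nrm x (ψ p) := by
    filter_upwards [hψ.eventually_analyticAt,
      hψ.continuousAt.eventually hx.eventually_analyticAt] with p' h1 h2
    exact nrm_comp h1 h2
  have hn : AnalyticAt ℝ (fun p => nrm x (ψ p)) p := (analyticAt_nrm hx).comp hψ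
  rw [pd_congr hev, pd_smul (analyticAt_jac hψ).differentiableAt hn,
    pd_comp hψ (analyticAt_nrm hx)]

theorem disc_comp (hψ : AnalyticAt ℝ ψ p) (hx : AnalyticAt ℝ x (ψ p)) :
    disc (fun p => x (ψ p)) p = jac ψ p ^ 4 * disc x (ψ p) := by
  rw [disc, dU_eq_pd, dV_eq_pd, pd_nrm_comp hψ hx, pd_nrm_comp hψ hx, nrm_comp hψ hx, disc,
    dU_eq_pd, dV_eq_pd]
  have hj : jac ψ p ^ 4 = jac ψ p ^ 3 *
    ((pd (1, 0) ψ p).1 * (pd (0, 1) ψ p).2 - (pd (1, 0) ψ p).2 * (pd (0, 1) ψ p).1) := by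
    rw [← jac]; ring
  rw [hj]
  simp only [triple_eq, Pi.add_apply, Pi.smul_apply, smul_eq_mul]
  ring

/-- The direction of the affine normal does not depend on the parametrization. -/
theorem normalVec_comp (hψ : AnalyticAt ℝ ψ p) (hx : AnalyticAt ℝ x (ψ p)) :
    normalVec (nrm fun p => x (ψ p)) (disc fun p => x (ψ p)) p =
      jac ψ p ^ 7 • normalVec (nrm x) (disc x) (ψ p) := by
  have hev : (disc fun p => x (ψ p)) =ᶠ[𝓝 p] fun p => jac ψ p ^ 4 * disc x (ψ p) := by
    filter_upwards [hψ.eventually_analyticAt,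
      hψ.continuousAt.eventually hx.eventually_analyticAt] with p' h1 h2
    exact disc_comp h1 h2
  have hJ := analyticAt_jac hψ
  have hD : AnalyticAt ℝ (fun p => disc x (ψ p)) p := (analyticAt_disc hx).comp hψ
  have hpd : ∀ w, pd w (disc fun p => x (ψ p)) p =
      4 * jac ψ p ^ 3 * pd w (jac ψ) p * disc x (ψ p) + jac ψ p ^ 4 *
        ((pd w ψ p).1 * pd (1, 0) (disc x) (ψ p) + (pd w ψ p).2 * pd (0, 1) (disc x) (ψ p)) := by
    intro w
    have h4 : pd w (fun p => jac ψ p ^ 4) p = 4 * jac ψ p ^ 3 * pd w (jac ψ) p := by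
      have : (fun p => jac ψ p ^ 4) = fun p => jac ψ p * jac ψ p * (jac ψ p * jac ψ p) :=
        funext fun p => by ring
      rw [this, pd_mul (f := fun p => jac ψ p * jac ψ p) (g := fun p => jac ψ p * jac ψ p)
        (hJ.mul hJ) (hJ.mul hJ), pd_mul hJ hJ]
      ring
    rw [pd_congr hev, pd_mul (f := fun p => jac ψ p ^ 4) (hJ.pow 4) hD,
      pd_comp hψ (analyticAt_disc hx), h4]
    simp only [smul_eq_mul]
  have hj : jac ψ p ^ 7 = jac ψ p ^ 6 *
    ((pd (1, 0) ψ p).1 * (pd (0, 1) ψ p).2 - (pd (1, 0) ψ p).2 * (pd (0, 1) ψ p).1) := by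
    rw [← jac]; ring
  rw [normalVec, hpd, hpd, pd_nrm_comp hψ hx, pd_nrm_comp hψ hx, nrm_comp hψ hx,
    hev.self_of_nhds, normalVec, hj]
  simp only [E3.ext_iff, cross_zero', cross_one', cross_two', Pi.add_apply, Pi.sub_apply,
    Pi.smul_apply, smul_eq_mul]
  refine ⟨?_, ?_, ?_⟩ <;> ring

end

/-! ### Dual bases -/

section

variable (b₁ b₂ e : E3)

theorem triple_smul_eq (v : E3) : triple b₁ b₂ e • v =
    (v ⬝ᵥ (b₂ ⨯₃ e)) • b₁ + (v ⬝ᵥ (e ⨯₃ b₁)) • b₂ + (v ⬝ᵥ (b₁ ⨯₃ b₂)) • e := by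
  simp only [E3.ext_iff, triple_eq, dot_eq, cross_zero', cross_one', cross_two', Pi.add_apply,
    Pi.smul_apply, smul_eq_mul]
  refine ⟨?_, ?_, ?_⟩ <;> ring

/-- Pairing of a covector and a vector given by coordinates with respect to dual bases. -/
theorem dual_dot (n₁ n₂ n₃ v₁ v₂ v₃ : ℝ) :
    (n₁ • (b₂ ⨯₃ e) + n₂ • (e ⨯₃ b₁) + n₃ • (b₁ ⨯₃ b₂)) ⬝ᵥ (v₁ • b₁ + v₂ • b₂ + v₃ • e) =
      triple b₁ b₂ e * (n₁ * v₁ + n₂ * v₂ + n₃ * v₃) := by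
  simp only [triple_eq, dot_eq, cross_zero', cross_one', cross_two', Pi.add_apply,
    Pi.smul_apply, smul_eq_mul]
  ring

theorem triple_comb (c₁ c₂ c₃ : E3) (l₁ l₂ l₃ m₁ m₂ m₃ n₁ n₂ n₃ : ℝ) :
    triple (l₁ • c₁ + l₂ • c₂ + l₃ • c₃) (m₁ • c₁ + m₂ • c₂ + m₃ • c₃)
      (n₁ • c₁ + n₂ • c₂ + n₃ • c₃) =
    triple c₁ c₂ c₃ * (l₁ * (m₂ * n₃ - n₂ * m₃) + l₂ * (m₃ * n₁ - n₃ * m₁) +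
      l₃ * (m₁ * n₂ - n₁ * m₂)) := by
  simp only [triple_eq, Pi.add_apply, Pi.smul_apply, smul_eq_mul]
  ring

theorem triple_dual : triple (b₂ ⨯₃ e) (e ⨯₃ b₁) (b₁ ⨯₃ b₂) = triple b₁ b₂ e ^ 2 := by
  simp only [triple_eq, cross_zero', cross_one', cross_two']
  ring

end

/-! ### The infinitesimal affine rotation of a surface with the two properties -/

/-- A generic point: the curvature is nonzero, the tangent plane is transversal to the axis, and
the point does not lie on the axis. -/
theorem exists_generic_point {x : ℝ × ℝ → E3} {U : Set (ℝ × ℝ)} (hU : IsOpen U)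
    (hx : ∀ q ∈ U, AnalyticAt ℝ x q) {a e : E3} (he : e ≠ 0) {q : ℝ × ℝ} (hq : q ∈ U)
    (hD : disc x q ≠ 0) :
    ∃ q ∈ U, disc x q ≠ 0 ∧ nrm x q ⬝ᵥ e ≠ 0 ∧ e ⨯₃ (x q - a) ≠ 0 := by
  have h1 : ∃ q ∈ U, disc x q ≠ 0 ∧ nrm x q ⬝ᵥ e ≠ 0 := by
    have h := mt (disc_eq_zero_of_dot he (hx q hq)) hD
    obtain ⟨p, hp, hpU, hpD⟩ := (Filter.not_eventually.1 h).and_eventually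
      (Filter.Eventually.and (hU.mem_nhds hq)
        ((analyticAt_disc (hx q hq)).continuousAt.eventually_ne hD)) |>.exists
    exact ⟨p, hpU, hpD, hp⟩
  obtain ⟨q, hq, hD, hn⟩ := h1
  have hxq := hx q hq
  have h2 : ¬ ∀ᶠ p in 𝓝 q, e ⨯₃ (x p - a) = 0 := by
    intro h
    have h3 := pd_cross (w := (1, 0)) (f := fun _ => e) (g := fun p => x p - a) analyticAt_const
      (hxq.sub analyticAt_const)
    rw [pd_congr (g := fun _ => (0 : E3)) h, pd_const, pd_const, pd_sub_const] at h3
    apply hn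
    rw [nrm, dotProduct_comm, triple_product_permutation, triple_product_permutation, dU_eq_pd]
    simp only [map_zero, LinearMap.zero_apply, zero_add] at h3
    rw [← h3, dotProduct_zero]
  have hne : ∀ᶠ p in 𝓝 q, nrm x p ⬝ᵥ e ≠ 0 :=
    (analyticAt_dot (analyticAt_nrm hxq) analyticAt_const).continuousAt.eventually_ne hn
  obtain ⟨p, hp, hpU, hpD, hpn⟩ := (Filter.not_eventually.1 h2).and_eventually
      (Filter.Eventually.and (hU.mem_nhds hq)
        (((analyticAt_disc hxq).continuousAt.eventually_ne hD).and hne)) |>.exists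
  exact ⟨p, hpU, hpD, hpn, hp⟩

/-- Meridian coordinates: near a generic point the surface is parametrized as
`a + s b₁ + s t b₂ + z(s, t) e`, where `t` numbers the planes through the axis. -/
theorem exists_meridian_chart {x : ℝ × ℝ → E3} {q₀ : ℝ × ℝ} (hx : AnalyticAt ℝ x q₀)
    {a e b₁ b₂ : E3} (hb : x q₀ - a = b₁) (hd : triple b₁ b₂ e ≠ 0)
    (hn : nrm x q₀ ⬝ᵥ e ≠ 0) {R : ℝ × ℝ → Prop} (hR : ∀ᶠ q in 𝓝 q₀, R q) :
    ∃ (ψ : ℝ × ℝ → ℝ × ℝ) (z : ℝ × ℝ → ℝ) (I J : Set ℝ), IsOpen I ∧ IsOpen J ∧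
      (∀ s ∈ I, s ≠ 0) ∧ (1, 0) ∈ I ×ˢ J ∧ ∀ p ∈ I ×ˢ J, AnalyticAt ℝ ψ p ∧ AnalyticAt ℝ z p ∧
        R (ψ p) ∧ x (ψ p) = a + (p.1 • b₁ + (p.1 * p.2) • b₂ + z p • e) ∧
        ∃ Φ : ℝ × ℝ → ℝ × ℝ, ContinuousAt Φ (ψ p) ∧ Φ (ψ p) = p ∧
          ∀ᶠ q in 𝓝 (ψ p), ψ (Φ q) = q := by
  set d := triple b₁ b₂ e with hddef
  have hl : ∀ β : E3, ∀ {q}, AnalyticAt ℝ x q →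
      AnalyticAt ℝ (fun q => ((x q - a) ⬝ᵥ β) / d) q := fun β q hq =>
    (analyticAt_dot (hq.sub analyticAt_const) analyticAt_const).div analyticAt_const hd
  set l₁ : ℝ × ℝ → ℝ := fun q => ((x q - a) ⬝ᵥ (b₂ ⨯₃ e)) / d with hl₁
  set l₂ : ℝ × ℝ → ℝ := fun q => ((x q - a) ⬝ᵥ (e ⨯₃ b₁)) / d with hl₂
  have h1 : l₁ q₀ = 1 := by
    rw [hl₁]; simp only; rw [hb, ← triple, div_self hd]
  have h2 : l₂ q₀ = 0 := by
    rw [hl₂]; simp only; rw [hb, dot_cross_self, zero_div]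
  set Φ : ℝ × ℝ → ℝ × ℝ := fun q => (l₁ q, l₂ q / l₁ q) with hΦdef
  have hΦ : ∀ {q}, AnalyticAt ℝ x q → l₁ q ≠ 0 → AnalyticAt ℝ Φ q := fun hq h0 =>
    (hl _ hq).prod ((hl _ hq).div (hl _ hq) h0)
  have hΦq : Φ q₀ = (1, 0) := by rw [hΦdef]; simp only; rw [h1, h2, zero_div]
  have h10 : l₁ q₀ ≠ 0 := by rw [h1]; exact one_ne_zero
  have hpdl : ∀ (β : E3) (w : ℝ × ℝ),
      pd w (fun q => ((x q - a) ⬝ᵥ β) / d) q₀ = (pd w x q₀ ⬝ᵥ β) / d := by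
    intro β w
    have := pd_mul (w := w) (f := fun q => (x q - a) ⬝ᵥ β) (g := fun _ => d⁻¹) (q := q₀)
      (analyticAt_dot (hx.sub analyticAt_const) analyticAt_const) analyticAt_const
    rw [pd_const, pd_dot (f := fun q => x q - a) (hx.sub analyticAt_const) analyticAt_const,
      pd_const, pd_sub_const] at this
    simpa [div_eq_mul_inv] using this
  have hinj : ∀ w, fderiv ℝ Φ q₀ w = 0 → w = 0 := by
    intro w hw
    have e1 : pd w l₁ q₀ = 0 := by
      have := pd_clm (w := w) (ContinuousLinearMap.fst ℝ ℝ ℝ) (hΦ hx h10)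
      have h3 : pd w Φ q₀ = 0 := hw
      rw [h3] at this
      exact this
    have e2 : pd w l₂ q₀ = 0 := by
      have := pd_clm (w := w) (ContinuousLinearMap.snd ℝ ℝ ℝ) (hΦ hx h10)
      have h3 : pd w Φ q₀ = 0 := hw
      rw [h3] at this
      have hev : l₂ =ᶠ[𝓝 q₀] fun q => (l₂ q / l₁ q) * l₁ q := by
        filter_upwards [(hl (b₂ ⨯₃ e) hx).continuousAt.eventually_ne h10] with q hq
        exact (div_mul_cancel₀ _ hq).symm
      rw [pd_congr hev, pd_mul (f := fun q => l₂ q / l₁ q) ((hl _ hx).div (hl _ hx) h10)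
        (hl _ hx), h2, e1]
      have h4 : pd w (fun q => l₂ q / l₁ q) q₀ = 0 := this
      rw [h4]; simp
    rw [hl₁, hpdl, div_eq_zero_iff, or_iff_left hd] at e1
    rw [hl₂, hpdl, div_eq_zero_iff, or_iff_left hd] at e2
    have h5 := triple_smul_eq b₁ b₂ e (pd w x q₀)
    rw [e1, e2, zero_smul, zero_smul, zero_add, zero_add] at h5
    have h6 := congrArg (fun v => nrm x q₀ ⬝ᵥ v) h5
    simp only [dotProduct_smul, nrm_dot_pd, smul_eq_mul, mul_zero] at h6
    have h7 := (mul_eq_zero.1 h6.symm).resolve_right hn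
    rw [h7, zero_smul] at h5
    have h8 : w.1 • pd (1, 0) x q₀ + w.2 • pd (0, 1) x q₀ = 0 := by
      rw [← fderiv_apply_eq_pd]
      exact (smul_eq_zero.1 h5).resolve_left hd
    have hn0 : nrm x q₀ ≠ 0 := by rintro h0; rw [h0, zero_dotProduct] at hn; exact hn rfl
    have h9 : w.1 • nrm x q₀ = 0 := by
      have := congrArg (fun v => v ⨯₃ pd (0, 1) x q₀) h8
      simpa [← dU_eq_pd, ← dV_eq_pd, nrm] using this
    have h10 : w.2 • nrm x q₀ = 0 := by
      have := congrArg (fun v => pd (1, 0) x q₀ ⨯₃ v) h8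
      simpa [← dU_eq_pd, ← dV_eq_pd, nrm] using this
    exact Prod.ext ((smul_eq_zero.1 h9).resolve_right hn0)
      ((smul_eq_zero.1 h10).resolve_right hn0)
  obtain ⟨ψ, hψ, hψ0, hr, hlft⟩ := exists_local_inverse (hΦ hx h10) hinj
  rw [hΦq] at hψ hψ0 hr
  have hgood : ∀ᶠ q in 𝓝 q₀, R q ∧ AnalyticAt ℝ x q ∧ l₁ q ≠ 0 ∧
      ∀ᶠ q' in 𝓝 q, ψ (Φ q') = q' :=
    hR.and (hx.eventually_analyticAt.and
      (((hl (b₂ ⨯₃ e) hx).continuousAt.eventually_ne h10).and hlft.eventually_nhds))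
  have hcont : Filter.Tendsto ψ (𝓝 (1, 0)) (𝓝 q₀) := by
    have := hψ.continuousAt; rwa [ContinuousAt, hψ0] at this
  have hbox := hψ.eventually_analyticAt.and (hr.and (hcont.eventually hgood))
  rw [nhds_prod_eq, Filter.eventually_prod_iff] at hbox
  obtain ⟨p1, hp1, p2, hp2, hbox⟩ := hbox
  obtain ⟨I, hI, hIo, h1I⟩ := eventually_nhds_iff.1 (hp1.and (eventually_ne_nhds one_ne_zero))
  obtain ⟨J, hJ, hJo, h0J⟩ := eventually_nhds_iff.1 hp2
  refine ⟨ψ, fun p => ((x (ψ p) - a) ⬝ᵥ (b₁ ⨯₃ b₂)) / d, I, J, hIo, hJo, fun s hs => (hI s hs).2,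
    ⟨h1I, h0J⟩, ?_⟩
  rintro ⟨s, t⟩ ⟨hs, ht⟩
  obtain ⟨k1, k2, k3, k4, k5, k6⟩ := hbox (hI s hs).1 (hJ t ht)
  refine ⟨k1, (hl _ k4).comp k1, k3, ?_, Φ, (hΦ k4 k5).continuousAt, k2, k6⟩
  have hs1 : l₁ (ψ (s, t)) = s := congrArg Prod.fst k2
  have ht1 : l₂ (ψ (s, t)) / l₁ (ψ (s, t)) = t := congrArg Prod.snd k2
  rw [div_eq_iff k5, hs1, hl₂] at ht1
  rw [hl₁] at hs1
  simp only at hs1 ht1 ⊢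
  rw [← sub_eq_iff_eq_add', mul_comm s t, ← ht1]
  nth_rewrite 2 [← hs1]
  have := congrArg (fun v => d⁻¹ • v) (triple_smul_eq b₁ b₂ e (x (ψ (s, t)) - a))
  simp only [smul_add, smul_smul, ← hddef, inv_mul_cancel₀ hd, one_smul] at this
  rw [div_eq_inv_mul, div_eq_inv_mul, div_eq_inv_mul]
  exact this

section

variable {b₁ b₂ e : E3} {z : ℝ × ℝ → ℝ} {y : ℝ × ℝ → E3} {p : ℝ × ℝ} {a : E3}

/-- The normal field of a surface in meridian coordinates. -/
theorem nrm_meridian (hz : AnalyticAt ℝ z p)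
    (hy : ∀ᶠ p in 𝓝 p, y p = a + (p.1 • b₁ + (p.1 * p.2) • b₂ + z p • e)) :
    nrm y p = (p.2 * pd (0, 1) z p - p.1 * pd (1, 0) z p) • (b₂ ⨯₃ e) +
      (-pd (0, 1) z p) • (e ⨯₃ b₁) + p.1 • (b₁ ⨯₃ b₂) := by
  obtain ⟨s, t⟩ := p
  have hyan : AnalyticAt ℝ y (s, t) := by
    refine AnalyticAt.congr ?_ (Filter.EventuallyEq.symm hy)
    exact analyticAt_const.add (((analyticAt_fst.smul analyticAt_const).add
      ((analyticAt_fst.mul analyticAt_snd).smul analyticAt_const)).add (hz.smul analyticAt_const))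
  have hcs : ContinuousAt (fun s' : ℝ => (s', t)) s := by fun_prop
  have hct : ContinuousAt (fun t' : ℝ => (s, t')) t := by fun_prop
  have h1 : dU y (s, t) = b₁ + t • b₂ + pd (1, 0) z (s, t) • e := by
    refine (hasDerivAt_fst hyan).unique (HasDerivAt.congr_of_eventuallyEq
      (((((hasDerivAt_id s).smul_const b₁).add (((hasDerivAt_id s).mul_const t).smul_const
        b₂)).add ((hasDerivAt_fst hz).smul_const e)).const_add a |>.congr_deriv ?_)
        (hcs.eventually hy))
    simp
  have h2 : dV y (s, t) = s • b₂ + pd (0, 1) z (s, t) • e := by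
    refine (hasDerivAt_snd hyan).unique (HasDerivAt.congr_of_eventuallyEq
      (((((hasDerivAt_const t s).smul_const b₁).add (((hasDerivAt_id t).const_mul s).smul_const
        b₂)).add ((hasDerivAt_snd hz).smul_const e)).const_add a |>.congr_deriv ?_)
        (hct.eventually hy))
    simp
  rw [nrm, h1, h2]
  simp only [E3.ext_iff, cross_zero', cross_one', cross_two', Pi.add_apply,
    Pi.smul_apply, smul_eq_mul]
  refine ⟨?_, ?_, ?_⟩ <;> ring

theorem pd_nrm_meridian (hz : AnalyticAt ℝ z p)
    (hy : ∀ᶠ p in 𝓝 p, y p = a + (p.1 • b₁ + (p.1 * p.2) • b₂ + z p • e)) :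
    pd (1, 0) (nrm y) p =
        (p.2 * pd (0, 1) (pd (1, 0) z) p - pd (1, 0) z p - p.1 * pd (1, 0) (pd (1, 0) z) p) •
          (b₂ ⨯₃ e) + (-pd (0, 1) (pd (1, 0) z) p) • (e ⨯₃ b₁) + (1 : ℝ) • (b₁ ⨯₃ b₂) ∧
      pd (0, 1) (nrm y) p =
        (pd (0, 1) z p + p.2 * pd (0, 1) (pd (0, 1) z) p - p.1 * pd (0, 1) (pd (1, 0) z) p) •
          (b₂ ⨯₃ e) + (-pd (0, 1) (pd (0, 1) z) p) • (e ⨯₃ b₁) + (0 : ℝ) • (b₁ ⨯₃ b₂) := by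
  have hev : nrm y =ᶠ[𝓝 p] fun p =>
      (p.2 * pd (0, 1) z p - p.1 * pd (1, 0) z p) • (b₂ ⨯₃ e) +
        (-pd (0, 1) z p) • (e ⨯₃ b₁) + p.1 • (b₁ ⨯₃ b₂) := by
    filter_upwards [hz.eventually_analyticAt, hy.eventually_nhds] with p' h1 h2
    exact nrm_meridian h1 h2
  have hP : AnalyticAt ℝ (pd (1, 0) z) p := analyticAt_pd hz
  have hQ : AnalyticAt ℝ (pd (0, 1) z) p := analyticAt_pd hz
  have hyan : AnalyticAt ℝ (nrm y) p := by
    refine AnalyticAt.congr ?_ hev.symm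
    exact ((((analyticAt_snd.mul hQ).sub (analyticAt_fst.mul hP)).smul analyticAt_const).add
      (hQ.neg.smul analyticAt_const)).add (analyticAt_fst.smul analyticAt_const)
  obtain ⟨s, t⟩ := p
  have hcs : ContinuousAt (fun s' : ℝ => (s', t)) s := by fun_prop
  have hct : ContinuousAt (fun t' : ℝ => (s, t')) t := by fun_prop
  have hQs := hasDerivAt_fst hQ
  rw [pd_comm hz (1, 0) (0, 1)] at hQs
  constructor
  · refine (hasDerivAt_fst hyan).unique (HasDerivAt.congr_of_eventuallyEq
      (((((hQs.const_mul t).sub ((hasDerivAt_id s).mul (hasDerivAt_fst hP))).smul_const _).add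
        (hQs.neg.smul_const _)).add ((hasDerivAt_id s).smul_const _) |>.congr_deriv ?_)
        (hcs.eventually hev))
    simp only [id, one_mul, sub_sub]
  · refine (hasDerivAt_snd hyan).unique (HasDerivAt.congr_of_eventuallyEq
      ((((((hasDerivAt_id t).mul (hasDerivAt_snd hQ)).sub ((hasDerivAt_snd hP).const_mul
        s)).smul_const _).add ((hasDerivAt_snd hQ).neg.smul_const _)).add
          ((hasDerivAt_const t s).smul_const _) |>.congr_deriv ?_)
        (hct.eventually hev))
    simp only [id, one_mul]

theorem disc_meridian (hz : AnalyticAt ℝ z p)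
    (hy : ∀ᶠ p in 𝓝 p, y p = a + (p.1 • b₁ + (p.1 * p.2) • b₂ + z p • e)) :
    disc y p = triple b₁ b₂ e ^ 2 *
      (p.1 ^ 2 * pd (1, 0) (pd (1, 0) z) p * pd (0, 1) (pd (0, 1) z) p
        - (p.1 * pd (0, 1) (pd (1, 0) z) p - pd (0, 1) z p) ^ 2) := by
  obtain ⟨h1, h2⟩ := pd_nrm_meridian hz hy
  rw [disc, dU_eq_pd, dV_eq_pd, h1, h2, nrm_meridian hz hy, triple_comb, triple_dual]
  ring

theorem triple_sub_smul (m n k e y : E3) (c₁ c₂ c₃ : ℝ) :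
    triple y e (c₁ • (n ⨯₃ k) - c₂ • (n ⨯₃ m) - c₃ • (m ⨯₃ k)) =
      c₁ * triple (y ⨯₃ e) n k - c₂ * triple (y ⨯₃ e) n m - c₃ * triple (y ⨯₃ e) m k := by
  simp only [triple_eq, cross_zero', cross_one', cross_two', Pi.sub_apply,
    Pi.smul_apply, smul_eq_mul]
  ring

/-- The condition on the affine normals in meridian coordinates. -/
theorem triple_normalVec_meridian (hz : AnalyticAt ℝ z p)
    (hy : ∀ᶠ p in 𝓝 p, y p = a + (p.1 • b₁ + (p.1 * p.2) • b₂ + z p • e)) :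
    triple (y p - a) e (normalVec (nrm y) (disc y) p) = triple b₁ b₂ e ^ 2 * p.1 *
      ((p.1 * pd (1, 0) (disc y) p - 4 * disc y p) *
        (p.1 * pd (0, 1) (pd (1, 0) z) p - pd (0, 1) z p) -
          p.1 ^ 2 * pd (1, 0) (pd (1, 0) z) p * pd (0, 1) (disc y) p) := by
  obtain ⟨h1, h2⟩ := pd_nrm_meridian hz hy
  have hμ : (y p - a) ⨯₃ e =
      (p.1 * p.2) • (b₂ ⨯₃ e) + (-p.1) • (e ⨯₃ b₁) + (0 : ℝ) • (b₁ ⨯₃ b₂) := by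
    rw [hy.self_of_nhds, add_sub_cancel_left]
    simp only [E3.ext_iff, cross_zero', cross_one', cross_two', Pi.add_apply,
      Pi.smul_apply, smul_eq_mul]
    refine ⟨?_, ?_, ?_⟩ <;> ring
  rw [normalVec, h1, h2, nrm_meridian hz hy, triple_sub_smul, hμ, triple_comb,
    triple_comb, triple_comb, triple_dual]
  ring

end

/-- The linear field that corresponds to the solution of the differential equations in meridian
coordinates: `M` is given by its values on the basis `b₁`, `b₂`, `e`. -/
theorem exists_matrix {b₁ b₂ e : E3} (hd : triple b₁ b₂ e ≠ 0) (k₀ k₁ k₂ d₀ d₁ : ℝ)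
    (hk : k₀ ≠ 0 ∨ k₁ ≠ 0 ∨ k₂ ≠ 0) :
    ∃ M : Matrix (Fin 3) (Fin 3) ℝ, M.trace = 0 ∧ M *ᵥ e = 0 ∧ M ≠ 0 ∧
      M *ᵥ b₁ = (-(k₁ / 2)) • b₁ + k₀ • b₂ + d₀ • e ∧
      M *ᵥ b₂ = (-k₂) • b₁ + (k₁ / 2) • b₂ + d₁ • e := by
  set d := triple b₁ b₂ e with hddef
  set w₁ := (-(k₁ / 2)) • b₁ + k₀ • b₂ + d₀ • e with hw₁
  set w₂ := (-k₂) • b₁ + (k₁ / 2) • b₂ + d₁ • e with hw₂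
  set M : Matrix (Fin 3) (Fin 3) ℝ :=
    d⁻¹ • (Matrix.vecMulVec w₁ (b₂ ⨯₃ e) + Matrix.vecMulVec w₂ (e ⨯₃ b₁)) with hM
  have hMv : ∀ v, M *ᵥ v =
      d⁻¹ • ((v ⬝ᵥ (b₂ ⨯₃ e)) • w₁ + (v ⬝ᵥ (e ⨯₃ b₁)) • w₂) := by
    intro v
    rw [hM, Matrix.smul_mulVec, Matrix.add_mulVec]
    simp only [E3.ext_iff, Matrix.mulVec, Matrix.vecMulVec_apply, dot_eq, Pi.add_apply,
      Pi.smul_apply, smul_eq_mul]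
    refine ⟨?_, ?_, ?_⟩ <;> ring
  have h1 : M *ᵥ b₁ = w₁ := by
    rw [hMv, dot_cross_self, zero_smul, add_zero, ← triple, smul_smul, inv_mul_cancel₀ hd,
      one_smul]
  have h2 : M *ᵥ b₂ = w₂ := by
    rw [hMv, dot_self_cross, zero_smul, zero_add, ← triple_product_permutation, ← triple,
      smul_smul, inv_mul_cancel₀ hd, one_smul]
  refine ⟨M, ?_, ?_, ?_, h1, h2⟩
  · rw [hM, Matrix.trace_smul, Matrix.trace_add, Matrix.trace_vecMulVec, Matrix.trace_vecMulVec,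
      hw₁, hw₂]
    simp only [dot_eq, cross_zero', cross_one', cross_two', Pi.add_apply, Pi.smul_apply,
      smul_eq_mul]
    ring
  · rw [hMv, dot_cross_self, dot_self_cross]; simp
  · intro h0
    have hz : ∀ l m n : ℝ, l • b₁ + m • b₂ + n • e = 0 → l = 0 ∧ m = 0 := by
      intro l m n h
      constructor
      · have := congrArg (fun v => triple v b₂ e) h
        simp only [triple_eq, Pi.add_apply, Pi.smul_apply, smul_eq_mul, Pi.zero_apply] at this
        refine (mul_eq_zero.1 (?_ : l * d = 0)).resolve_right hd
        rw [hddef, triple_eq]; linear_combination this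
      · have := congrArg (fun v => triple b₁ v e) h
        simp only [triple_eq, Pi.add_apply, Pi.smul_apply, smul_eq_mul, Pi.zero_apply] at this
        refine (mul_eq_zero.1 (?_ : m * d = 0)).resolve_right hd
        rw [hddef, triple_eq]; linear_combination this
    rw [h0, Matrix.zero_mulVec] at h1 h2
    have h3 := hz _ _ _ h1.symm
    have h4 := hz _ _ _ h2.symm
    have : k₁ = 0 := by linarith [h3.1]
    have : k₂ = 0 := by linarith [h4.1]
    have := h3.2
    tauto

/-- The two geometric conditions force a surface to be tangent, near some point, to an
infinitesimal affine rotation. -/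
theorem exists_generator {x : ℝ × ℝ → E3} {U : Set (ℝ × ℝ)} (hU : IsOpen U)
    (hx : ∀ q ∈ U, AnalyticAt ℝ x q) {a e : E3} (he : e ≠ 0)
    (hN : ∀ q ∈ U, disc x q ≠ 0 → triple (x q - a) e (normalVec (nrm x) (disc x) q) = 0)
    (hS : ∀ h : E3, h ⨯₃ e ≠ 0 → ∃ v ≠ 0, ∀ q ∈ U, disc x q ≠ 0 →
      (∃ s : ℝ, s ≠ 0 ∧ ∃ t : ℝ, x q - a = s • h + t • e) → nrm x q ⬝ᵥ v = 0)
    {q : ℝ × ℝ} (hq : q ∈ U) (hD : disc x q ≠ 0) :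
    ∃ M : Matrix (Fin 3) (Fin 3) ℝ, M.trace = 0 ∧ M *ᵥ e = 0 ∧ M ≠ 0 ∧
      ∃ q ∈ U, disc x q ≠ 0 ∧ ∀ᶠ p in 𝓝 q, nrm x p ⬝ᵥ (M *ᵥ (x p - a)) = 0 := by
  obtain ⟨q₀, hq₀, hD₀, hn₀, ha₀⟩ := exists_generic_point hU hx he hq hD
  set b₁ := x q₀ - a with hb₁
  set b₂ := e ⨯₃ b₁ with hb₂
  have hd : triple b₁ b₂ e ≠ 0 := by
    rw [triple, triple_product_permutation]
    exact (dot_self_pos ha₀).ne'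
  have hR : ∀ᶠ q in 𝓝 q₀, q ∈ U ∧ disc x q ≠ 0 ∧ nrm x q ≠ 0 :=
    Filter.Eventually.and (hU.mem_nhds hq₀)
      (((analyticAt_disc (hx q₀ hq₀)).continuousAt.eventually_ne hD₀).and
        ((analyticAt_nrm (hx q₀ hq₀)).continuousAt.eventually_ne (nrm_ne_zero_of_disc hD₀)))
  obtain ⟨ψ, z, I, J, hI, hJ, hI0, h10, hbox⟩ :=
    exists_meridian_chart (hx q₀ hq₀) hb₁.symm hd hn₀ hR
  set y : ℝ × ℝ → E3 := fun p => x (ψ p) with hy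
  set d := triple b₁ b₂ e with hddef
  have hIJ : IsOpen (I ×ˢ J) := hI.prod hJ
  have hye : ∀ p ∈ I ×ˢ J, ∀ᶠ p in 𝓝 p, y p = a + (p.1 • b₁ + (p.1 * p.2) • b₂ + z p • e) :=
    fun p hp => Filter.Eventually.mono (hIJ.mem_nhds hp) fun p hp => (hbox p hp).2.2.2.1
  have hz : ∀ p ∈ I ×ˢ J, AnalyticAt ℝ z p := fun p hp => (hbox p hp).2.1
  have hxψ : ∀ p ∈ I ×ˢ J, AnalyticAt ℝ x (ψ p) := fun p hp => hx _ (hbox p hp).2.2.1.1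
  have hnc : ∀ p ∈ I ×ˢ J, nrm y p = jac ψ p • nrm x (ψ p) := fun p hp =>
    nrm_comp (hbox p hp).1 (hxψ p hp)
  have hndot : ∀ p ∈ I ×ˢ J, ∀ v₁ v₂ v₃ : ℝ, nrm y p ⬝ᵥ (v₁ • b₁ + v₂ • b₂ + v₃ • e) =
      d * ((p.2 * pd (0, 1) z p - p.1 * pd (1, 0) z p) * v₁ + (-pd (0, 1) z p) * v₂ +
        p.1 * v₃) := by
    intro p hp v₁ v₂ v₃
    rw [nrm_meridian (hz p hp) (hye p hp), dual_dot]
  have hj : ∀ p ∈ I ×ˢ J, jac ψ p ≠ 0 := by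
    intro p hp hj
    have h1 := hndot p hp 0 0 1
    rw [hnc p hp, hj, zero_smul, zero_dotProduct] at h1
    have h2 := hI0 p.1 hp.1
    simp [hd, h2] at h1
  have hyan : ∀ p ∈ I ×ˢ J, AnalyticAt ℝ y p := fun p hp => (hxψ p hp).comp (hbox p hp).1
  have hDc : ∀ p ∈ I ×ˢ J, disc y p = jac ψ p ^ 4 * disc x (ψ p) := fun p hp =>
    disc_comp (hbox p hp).1 (hxψ p hp)
  have hDy0 : ∀ p ∈ I ×ˢ J, disc y p ≠ 0 := fun p hp => by
    rw [hDc p hp]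
    exact mul_ne_zero (pow_ne_zero _ (hj p hp)) (hbox p hp).2.2.1.2.1
  have hpdD : ∀ p ∈ I ×ˢ J, ∀ w, pd w (fun p => disc y p / d ^ 2) p = pd w (disc y) p / d ^ 2 := by
    intro p hp w
    have := pd_mul (w := w) (g := fun _ => (d ^ 2)⁻¹) (analyticAt_disc (hyan p hp))
      analyticAt_const
    rw [pd_const] at this
    simpa [div_eq_mul_inv] using this
  have hd2 : d ^ 2 ≠ 0 := pow_ne_zero 2 hd
  obtain ⟨p₁, hp₁, k₀, k₁, k₂, d₀, d₁, hk, hev⟩ := exists_linear_tangent_field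
    (D := fun p => disc y p / d ^ 2) hI hJ hI0 hz
    (fun p hp => by
      rw [div_eq_iff hd2, disc_meridian (hz p hp) (hye p hp)]; ring)
    (fun p hp => div_ne_zero (hDy0 p hp) hd2)
    (fun p hp => by
      have h1 := triple_normalVec_meridian (hz p hp) (hye p hp)
      have h2 := hN _ (hbox p hp).2.2.1.1 (hbox p hp).2.2.1.2.1
      rw [hy, normalVec_comp (hbox p hp).1 (hxψ p hp), triple_smul_right, h2, mul_zero] at h1
      have h3 := (mul_eq_zero.1 h1.symm).resolve_left (mul_ne_zero hd2 (hI0 p.1 hp.1))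
      rw [hpdD p hp, hpdD p hp]
      field_simp
      linear_combination h3)
    (fun t ht => by
      have hh : (b₁ + t • b₂) ⨯₃ e ≠ 0 := by
        intro h0
        have := congrArg (fun v => b₂ ⬝ᵥ v) h0
        apply hd
        rw [hddef, triple_eq]
        simp only [dot_eq, cross_zero', cross_one', cross_two', Pi.add_apply, Pi.smul_apply,
          smul_eq_mul, Pi.zero_apply] at this
        linear_combination -this
      obtain ⟨v, hv0, hv⟩ := hS _ hh
      have hvd := triple_smul_eq b₁ b₂ e v
      refine ⟨v ⬝ᵥ (b₂ ⨯₃ e), v ⬝ᵥ (e ⨯₃ b₁), v ⬝ᵥ (b₁ ⨯₃ b₂), ?_, fun s hs => ?_⟩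
      · by_contra! hcon
        rw [hcon.1, hcon.2.1, hcon.2.2] at hvd
        simp only [zero_smul, add_zero] at hvd
        exact hv0 ((smul_eq_zero.1 hvd).resolve_left hd)
      · have hp : (s, t) ∈ I ×ˢ J := ⟨hs, ht⟩
        have h1 := hv _ (hbox _ hp).2.2.1.1 (hbox _ hp).2.2.1.2.1
          ⟨s, hI0 s hs, z (s, t), by
            rw [(hbox _ hp).2.2.2.1, add_sub_cancel_left, smul_add, smul_smul]⟩
        have h2 := hndot _ hp (v ⬝ᵥ (b₂ ⨯₃ e)) (v ⬝ᵥ (e ⨯₃ b₁)) (v ⬝ᵥ (b₁ ⨯₃ b₂))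
        rw [← hvd, hnc _ hp, smul_dotProduct, dotProduct_smul, h1, smul_zero, smul_zero] at h2
        have h3 := (mul_eq_zero.1 h2.symm).resolve_left hd
        simp only at h3
        linear_combination h3)
    h10
  obtain ⟨M, hM1, hM2, hM3, hMb₁, hMb₂⟩ := exists_matrix (e := e) hd k₀ k₁ k₂ d₀ d₁ hk
  obtain ⟨-, -, hUψ, -, Φ, hΦc, hΦp, hΦl⟩ := hbox p₁ hp₁
  refine ⟨M, hM1, hM2, hM3, ψ p₁, hUψ.1, hUψ.2.1, ?_⟩
  have hev' : ∀ᶠ p in 𝓝 p₁, nrm x (ψ p) ⬝ᵥ (M *ᵥ (x (ψ p) - a)) = 0 := by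
    filter_upwards [hev, hIJ.mem_nhds hp₁] with p h1 hp
    have h2 : M *ᵥ (x (ψ p) - a) = (-p.1 * (k₁ / 2) - p.1 * p.2 * k₂) • b₁ +
        (p.1 * k₀ + p.1 * p.2 * (k₁ / 2)) • b₂ + (p.1 * d₀ + p.1 * p.2 * d₁) • e := by
      rw [(hbox p hp).2.2.2.1, add_sub_cancel_left, Matrix.mulVec_add, Matrix.mulVec_add,
        Matrix.mulVec_smul, Matrix.mulVec_smul, Matrix.mulVec_smul, hM2, hMb₁, hMb₂]
      module
    have h3 := hndot p hp (-p.1 * (k₁ / 2) - p.1 * p.2 * k₂)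
      (p.1 * k₀ + p.1 * p.2 * (k₁ / 2)) (p.1 * d₀ + p.1 * p.2 * d₁)
    rw [← h2, hnc p hp, smul_dotProduct] at h3
    refine (smul_eq_zero.1 (h3.trans ?_)).resolve_left (hj p hp)
    linear_combination (-d * p.1) * h1
  rw [← hΦp] at hev'
  filter_upwards [hΦc.eventually hev', hΦl] with q h1 h2
  rw [h2] at h1
  exact h1

/-! ### One-parameter groups and their generators -/

section

variable {φ : ℝ → Matrix (Fin 3) (Fin 3) ℝ} {M : Matrix (Fin 3) (Fin 3) ℝ}

theorem det_eq_triple (N : Matrix (Fin 3) (Fin 3) ℝ) :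
    N.det = triple (N *ᵥ Pi.single 0 1) (N *ᵥ Pi.single 1 1) (N *ᵥ Pi.single 2 1) := by
  rw [Matrix.det_fin_three, triple_eq]
  simp only [Matrix.mulVec_single_one, Matrix.col_apply]
  ring

theorem hasDerivAt_triple {a b c : ℝ → E3} {a' b' c' : E3} {t : ℝ} (ha : HasDerivAt a a' t)
    (hb : HasDerivAt b b' t) (hc : HasDerivAt c c' t) :
    HasDerivAt (fun t => triple (a t) (b t) (c t))
      (triple a' (b t) (c t) + triple (a t) b' (c t) + triple (a t) (b t) c') t := by
  rw [hasDerivAt_pi] at ha hb hc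
  simp only [triple_eq]
  refine (((ha 0).mul (((hb 1).mul (hc 2)).sub ((hb 2).mul (hc 1)))).add
    ((ha 1).mul (((hb 2).mul (hc 0)).sub ((hb 0).mul (hc 2))))).add
      ((ha 2).mul (((hb 0).mul (hc 1)).sub ((hb 1).mul (hc 0)))) |>.congr_deriv ?_
  simp only [Pi.sub_apply, Pi.mul_apply]
  ring

theorem hasDerivAt_det {t : ℝ}
    (h : ∀ v, HasDerivAt (fun t => φ t *ᵥ v) (M *ᵥ (φ t *ᵥ v)) t) :
    HasDerivAt (fun t => (φ t).det) (M.trace * (φ t).det) t := by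
  simp only [det_eq_triple]
  rw [← triple_mulVec_add]
  exact hasDerivAt_triple (h _) (h _) (h _)

theorem hasDerivAt_group_left (hadd : ∀ s t, φ (s + t) = φ s * φ t)
    (h : ∀ v, HasDerivAt (fun t => φ t *ᵥ v) (M *ᵥ v) 0) (t : ℝ) (v : E3) :
    HasDerivAt (fun t => φ t *ᵥ v) (M *ᵥ (φ t *ᵥ v)) t := by
  have h1 := h (φ t *ᵥ v)
  rw [← sub_self t] at h1
  have h2 := h1.comp_sub_const t t
  simp only [Matrix.mulVec_mulVec, ← hadd, sub_add_cancel] at h2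
  rwa [Matrix.mulVec_mulVec]

theorem hasDerivAt_group_right (hadd : ∀ s t, φ (s + t) = φ s * φ t)
    (h : ∀ v, HasDerivAt (fun t => φ t *ᵥ v) (M *ᵥ v) 0) (t : ℝ) (v : E3) :
    HasDerivAt (fun t => φ t *ᵥ v) (φ t *ᵥ (M *ᵥ v)) t := by
  have h1 := (LinearMap.toContinuousLinearMap (Matrix.mulVecLin (φ t))).hasFDerivAt.comp_hasDerivAt
    0 (h v)
  rw [← sub_self t] at h1
  have h2 := h1.comp_sub_const t t
  simp only [Function.comp_def, LinearMap.coe_toContinuousLinearMap', Matrix.mulVecLin_apply,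
    Matrix.mulVec_mulVec, ← hadd, add_sub_cancel] at h2
  rwa [Matrix.mulVec_mulVec]

theorem group_fixes_of_mulVec_eq_zero (h0 : φ 0 = 1) (hadd : ∀ s t, φ (s + t) = φ s * φ t)
    (h : ∀ v, HasDerivAt (fun t => φ t *ᵥ v) (M *ᵥ v) 0) {w : E3} (hw : M *ᵥ w = 0) (t : ℝ) :
    φ t *ᵥ w = w := by
  have hd : ∀ t, HasDerivAt (fun t => φ t *ᵥ w) 0 t := fun t =>
    (hasDerivAt_group_right hadd h t w).congr_deriv (by rw [hw, Matrix.mulVec_zero])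
  have := is_const_of_deriv_eq_zero (fun t => (hd t).differentiableAt) (fun t => (hd t).deriv) t 0
  rw [this, h0, Matrix.one_mulVec]

/-- The generator of an affine rotation group. -/
theorem IsRotationGroup.exists_generator {D : Submodule ℝ E3} (hφ : IsRotationGroup D φ) :
    ∃ M : Matrix (Fin 3) (Fin 3) ℝ, M.trace = 0 ∧ (∀ w, M *ᵥ w = 0 ↔ w ∈ D) ∧
      ∀ v, HasDerivAt (fun t => φ t *ᵥ v) (M *ᵥ v) 0 := by
  set M : Matrix (Fin 3) (Fin 3) ℝ := Matrix.of fun i j => deriv (fun t => φ t i j) 0 with hM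
  have h : ∀ v, HasDerivAt (fun t => φ t *ᵥ v) (M *ᵥ v) 0 := by
    intro v
    rw [hasDerivAt_pi]
    intro i
    simp only [Matrix.mulVec, dotProduct]
    exact HasDerivAt.fun_sum fun j _ => (hφ.differentiable i j 0).hasDerivAt.mul_const (v j)
  refine ⟨M, ?_, fun w => ⟨fun hw => ?_, fun hw => ?_⟩, h⟩
  · have h1 := hasDerivAt_det (hasDerivAt_group_left hφ.map_add h 0)
    simp only [hφ.det_eq_one, mul_one] at h1
    exact h1.unique (hasDerivAt_const 0 1)
  · exact (hφ.fixed_iff w).1 (group_fixes_of_mulVec_eq_zero hφ.map_zero hφ.map_add h hw)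
  · have h1 := h w
    simp only [(hφ.fixed_iff w).2 hw] at h1
    exact h1.unique (hasDerivAt_const 0 w)

/-- Every linear vector field of trace zero generates an affine rotation group. -/
theorem exists_isRotationGroup {D : Submodule ℝ E3} (hM : M.trace = 0)
    (hD : ∀ w, M *ᵥ w = 0 ↔ w ∈ D) :
    ∃ φ : ℝ → Matrix (Fin 3) (Fin 3) ℝ, IsRotationGroup D φ ∧
      ∀ t v, HasDerivAt (fun t => φ t *ᵥ v) (M *ᵥ (φ t *ᵥ v)) t := by
  set T : E3 →L[ℝ] E3 := LinearMap.toContinuousLinearMap (Matrix.mulVecLin M) with hT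
  set φ : ℝ → Matrix (Fin 3) (Fin 3) ℝ := fun t =>
    LinearMap.toMatrix' (NormedSpace.exp (t • T) : E3 →L[ℝ] E3).toLinearMap with hφ
  have hv : ∀ t v, φ t *ᵥ v = (NormedSpace.exp (t • T) : E3 →L[ℝ] E3) v := by
    intro t v
    rw [hφ, LinearMap.toMatrix'_mulVec]; rfl
  have h0 : φ 0 = 1 := by
    rw [hφ]; simp
  have hadd : ∀ s t, φ (s + t) = φ s * φ t := by
    intro s t
    let : NormedAlgebra ℚ (E3 →L[ℝ] E3) := NormedAlgebra.restrictScalars ℚ ℝ _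
    simp only [hφ]
    rw [← LinearMap.toMatrix'_mul, add_smul, NormedSpace.exp_add_of_commute]
    · rfl
    · exact ((Commute.refl T).smul_left s).smul_right t
  have hd0 : ∀ v, HasDerivAt (fun t => φ t *ᵥ v) (M *ᵥ v) 0 := by
    intro v
    have h1 := (hasDerivAt_exp_smul_const T (0 : ℝ)).clm_apply (hasDerivAt_const 0 v)
    simp only [hv]
    simp only [zero_smul, NormedSpace.exp_zero, one_mul, map_zero, add_zero] at h1
    exact h1
  have hd := hasDerivAt_group_left hadd hd0
  refine ⟨φ, ⟨h0, hadd, ?_, ?_, fun w => ⟨fun hw => ?_, fun hw => ?_⟩⟩, hd⟩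
  · intro t
    have h1 : ∀ t, HasDerivAt (fun t => (φ t).det) 0 t := fun t =>
      (hasDerivAt_det (hd t)).congr_deriv (by rw [hM, zero_mul])
    have := is_const_of_deriv_eq_zero (fun t => (h1 t).differentiableAt)
      (fun t => (h1 t).deriv) t 0
    rw [this, h0, Matrix.det_one]
  · intro i j t
    have h1 := (hasDerivAt_pi.1 (hd t (Pi.single j 1))) i
    simp only [Matrix.mulVec_single_one, Matrix.col_apply] at h1
    exact h1.differentiableAt
  · have h1 := hd0 w
    simp only [hw] at h1
    exact (hD w).1 (h1.unique (hasDerivAt_const 0 w))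
  · exact group_fixes_of_mulVec_eq_zero h0 hadd hd0 ((hD w).2 hw)

end

/-! ### Invariant surfaces and tangent vector fields -/

section

variable {φ : ℝ → Matrix (Fin 3) (Fin 3) ℝ} {M : Matrix (Fin 3) (Fin 3) ℝ} {a : E3}
  {x : ℝ × ℝ → E3} {q : ℝ × ℝ}

theorem fderiv_injective (hn : nrm x q ≠ 0) : Function.Injective (fderiv ℝ x q) := by
  rw [injective_iff_map_eq_zero]
  intro w hw
  rw [fderiv_apply_eq_pd] at hw
  have h9 : w.1 • nrm x q = 0 := by
    have := congrArg (fun v => v ⨯₃ pd (0, 1) x q) hw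
    simpa [← dU_eq_pd, ← dV_eq_pd, nrm] using this
  have h10 : w.2 • nrm x q = 0 := by
    have := congrArg (fun v => pd (1, 0) x q ⨯₃ v) hw
    simpa [← dU_eq_pd, ← dV_eq_pd, nrm] using this
  exact Prod.ext ((smul_eq_zero.1 h9).resolve_right hn) ((smul_eq_zero.1 h10).resolve_right hn)

/-- A differentiable curve lying on arbitrarily small pieces of a surface is tangent to it. -/
theorem nrm_dot_eq_zero_of_curve (hx : AnalyticAt ℝ x q) (hn : nrm x q ≠ 0) {γ : ℝ → E3} {w : E3}
    (hγ : HasDerivAt γ w 0) (h0 : γ 0 = x q)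
    (h : ∀ V ∈ 𝓝 q, ∀ᶠ t in 𝓝 (0 : ℝ), γ t ∈ x '' V) : nrm x q ⬝ᵥ w = 0 := by
  set N : E3 →L[ℝ] ℝ := LinearMap.toContinuousLinearMap
    (dotProductBilin ℝ ℝ (nrm x q) : E3 →ₗ[ℝ] ℝ) with hN
  have hNv : ∀ v, N v = nrm x q ⬝ᵥ v := fun v => rfl
  have hxd := hx.differentiableAt.hasFDerivAt
  obtain ⟨K, -, hK⟩ := (LinearMap.injective_iff_antilipschitz
    (fderiv ℝ x q : ℝ × ℝ →ₗ[ℝ] E3)).1 (fderiv_injective hn)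
  have hO := (hxd.isTheta_sub
    (hK.isUniformInducing (fderiv ℝ x q).uniformContinuous).isInducing).symm.isBigO
  have ho : (fun p => N (x p - x q)) =o[𝓝 q] fun p => x p - x q := by
    have h1 := (N.hasFDerivAt.comp q hxd).isLittleO.trans_isBigO hO
    refine h1.congr_left fun p => ?_
    have h2 : N (fderiv ℝ x q (p - q)) = 0 := nrm_dot_pd x q (p - q)
    rw [ContinuousLinearMap.comp_apply, h2, sub_zero, map_sub]
    rfl
  have ho' : (fun t => N (γ t - γ 0)) =o[𝓝 0] fun t => γ t - γ 0 := by
    rw [Asymptotics.isLittleO_iff] at ho ⊢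
    intro c hc
    filter_upwards [h _ (ho hc)] with t ht
    obtain ⟨p, hp, hpt⟩ := ht
    rw [← hpt, h0]
    exact hp
  have h3 : HasDerivAt (fun t => N (γ t)) 0 0 := by
    rw [hasDerivAt_iff_isLittleO]
    refine (ho'.trans_isBigO hγ.isBigO_sub).congr_left fun t => ?_
    simp [map_sub]
  rw [← hNv]
  exact (N.hasFDerivAt.comp_hasDerivAt 0 hγ).unique h3

theorem hasDerivAt_moveAbout {t : ℝ} {p : E3}
    (hd : HasDerivAt (fun t => φ t *ᵥ (p - a)) (M *ᵥ (φ t *ᵥ (p - a))) t) :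
    HasDerivAt (fun t => moveAbout a (φ t) p) (M *ᵥ (moveAbout a (φ t) p - a)) t := by
  simp only [moveAbout, add_sub_cancel_left]
  exact hd.const_add a

/-- A surface tangent to a linear vector field is locally invariant under its flow. -/
theorem eventually_moveAbout_mem (hx : AnalyticAt ℝ x q) (hn : nrm x q ≠ 0)
    (ht : ∀ᶠ p in 𝓝 q, nrm x p ⬝ᵥ (M *ᵥ (x p - a)) = 0) (h0 : φ 0 = 1)
    (hd : ∀ t v, HasDerivAt (fun t => φ t *ᵥ v) (M *ᵥ (φ t *ᵥ v)) t) {V : Set (ℝ × ℝ)}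
    (hV : V ∈ 𝓝 q) : ∀ᶠ t in 𝓝 (0 : ℝ), moveAbout a (φ t) (x q) ∈ x '' V := by
  obtain ⟨α, β, hα, hβ, hw⟩ := exists_tangent_coefficients hx hn ht
  have hf : ContDiffAt ℝ 1 (fun p => (α p, β p)) q := (hα.prod hβ).contDiffAt
  obtain ⟨γ, hγ0, ε, hε, hγ⟩ :=
    hf.exists_forall_mem_closedBall_exists_eq_forall_mem_Ioo_hasDerivAt₀ 0
  have hγc : ContinuousAt γ 0 := (hγ 0 ⟨by linarith, by linarith⟩).continuousAt
  have hq : ∀ᶠ p in 𝓝 (γ 0), AnalyticAt ℝ x p ∧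
      M *ᵥ (x p - a) = α p • pd (1, 0) x p + β p • pd (0, 1) x p := by
    rw [hγ0]; exact hx.eventually_analyticAt.and hw
  have hev := (hγc.eventually hq).and (Ioo_mem_nhds (by linarith : 0 - ε < 0)
    (by linarith : 0 < 0 + ε) : ∀ᶠ t in 𝓝 (0 : ℝ), t ∈ Set.Ioo (0 - ε) (0 + ε))
  obtain ⟨δ, hδ, hball⟩ := Metric.eventually_nhds_iff_ball.1 hev
  rw [Real.ball_eq_Ioo] at hball
  have hsol : ∀ t ∈ Set.Ioo (0 - δ) (0 + δ),
      HasDerivAt (fun t => x (γ t) - a) (M *ᵥ (x (γ t) - a)) t := by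
    intro t ht
    obtain ⟨⟨h1, h2⟩, h3⟩ := hball t ht
    have h4 := (h1.differentiableAt.hasFDerivAt.comp_hasDerivAt t (hγ t h3)).sub_const a
    refine h4.congr_deriv ?_
    rw [h2, fderiv_apply_eq_pd]
  set T : E3 →L[ℝ] E3 := LinearMap.toContinuousLinearMap (Matrix.mulVecLin M) with hT
  have huniq : Set.EqOn (fun t => x (γ t) - a) (fun t => φ t *ᵥ (x q - a))
      (Set.Ioo (0 - δ) (0 + δ)) :=
    ODE_solution_unique_of_mem_Ioo (v := fun _ => T) (s := fun _ => Set.univ)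
      (fun t _ => T.lipschitz.lipschitzOnWith) (t₀ := 0) ⟨by linarith, by linarith⟩
      (fun t ht => ⟨hsol t ht, trivial⟩) (fun t _ => ⟨hd t _, trivial⟩)
      (by simp only [hγ0, h0, Matrix.one_mulVec])
  have hV' : ∀ᶠ t in 𝓝 (0 : ℝ), γ t ∈ V := by
    refine hγc ?_
    rwa [hγ0]
  filter_upwards [hV', Ioo_mem_nhds (by linarith : 0 - δ < 0) (by linarith : 0 < 0 + δ)]
    with t h1 h2
  refine ⟨γ t, h1, ?_⟩
  have h3 := huniq h2
  simp only at h3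
  rw [moveAbout, ← h3, add_sub_cancel]

end

/-! ### Polynomials vanishing on surfaces -/

theorem mvPolynomial_eq_zero_of_eventually {n : ℕ} {F : MvPolynomial (Fin n) ℝ} {p : Fin n → ℝ}
    (h : ∀ᶠ y in 𝓝 p, MvPolynomial.eval y F = 0) : F = 0 := by
  obtain ⟨ε, hε, hball⟩ := Metric.eventually_nhds_iff_ball.1 h
  refine MvPolynomial.funext_set (fun i => Metric.ball (p i) ε) (fun i => ?_) fun y hy => ?_
  · rw [Real.ball_eq_Ioo]
    exact Set.Ioo_infinite (by linarith)
  · rw [map_zero]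
    refine hball y ?_
    rw [ball_pi p hε]
    exact hy

/-- Elimination of the first variable: the common zeros of an irreducible polynomial and a
polynomial that it does not divide satisfy an equation in the remaining variables. -/
theorem exists_eliminant {F G : MvPolynomial (Fin 3) ℝ} (hF : Irreducible F) (hFG : ¬ F ∣ G) :
    ∃ H : MvPolynomial (Fin 2) ℝ, H ≠ 0 ∧ ∀ p : Fin 3 → ℝ, MvPolynomial.eval p F = 0 →
      MvPolynomial.eval p G = 0 → MvPolynomial.eval (fun i => p i.succ) H = 0 := by
  set R := MvPolynomial (Fin 2) ℝ
  set K := FractionRing R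
  set E := MvPolynomial.finSuccEquiv ℝ 2
  have heval : ∀ (p : Fin 3 → ℝ) (f : MvPolynomial (Fin 3) ℝ), MvPolynomial.eval p f =
      Polynomial.eval (p 0) (Polynomial.map (MvPolynomial.eval fun i => p i.succ) (E f)) := by
    intro p f
    rw [← MvPolynomial.eval_eq_eval_mv_eval']
    congr 1
    rw [← Fin.cons_self_tail p]; rfl
  have hP : Irreducible (E F) := (MulEquiv.irreducible_iff E.toMulEquiv).2 hF
  have hPQ : ¬ E F ∣ E G := fun h => hFG ((map_dvd_iff E).1 h)
  by_cases hdeg : (E F).natDegree = 0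
  · obtain ⟨H, hH⟩ := Polynomial.natDegree_eq_zero.1 hdeg
    refine ⟨H, ?_, fun p h1 _ => ?_⟩
    · rintro rfl
      rw [map_zero] at hH
      exact hP.ne_zero hH.symm
    · rw [heval, ← hH, Polynomial.map_C, Polynomial.eval_C] at h1
      exact h1
  have hprim := hP.isPrimitive hdeg
  have hirr := (hprim.irreducible_iff_irreducible_map_fraction_map (K := K)).1 hP
  have hndvd : ¬ (E F).map (algebraMap R K) ∣ (E G).map (algebraMap R K) := fun h =>
    hPQ (hprim.dvd_of_fraction_map_dvd_fraction_map h)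
  obtain ⟨A, B, hAB⟩ := (hirr.coprime_iff_not_dvd).2 hndvd
  obtain ⟨a, ha, hA⟩ := IsLocalization.integerNormalization_spec (nonZeroDivisors R) A
  obtain ⟨b, hb, hB⟩ := IsLocalization.integerNormalization_spec (nonZeroDivisors R) B
  set A' := IsLocalization.integerNormalization (nonZeroDivisors R) A
  set B' := IsLocalization.integerNormalization (nonZeroDivisors R) B
  have key : Polynomial.C b * A' * E F + Polynomial.C a * B' * E G = Polynomial.C (a * b) := by
    apply Polynomial.map_injective _ (IsFractionRing.injective R K)
    simp only [Polynomial.map_add, Polynomial.map_mul, Polynomial.map_C, hA, hB]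
    have h1 : ∀ (c : R) (T : Polynomial K), (c • T) = Polynomial.C (algebraMap R K c) * T := by
      intro c T
      rw [← Polynomial.smul_eq_C_mul, algebraMap_smul]
    simp only [h1, map_mul]
    linear_combination (Polynomial.C (algebraMap R K a) * Polynomial.C (algebraMap R K b)) * hAB
  refine ⟨a * b, mul_ne_zero (nonZeroDivisors.ne_zero ha) (nonZeroDivisors.ne_zero hb),
    fun p h1 h2 => ?_⟩
  have h3 := congrArg (fun T => Polynomial.eval (p 0)
    (Polynomial.map (MvPolynomial.eval fun i => p i.succ) T)) key
  rw [heval] at h1 h2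
  simp only [Polynomial.map_add, Polynomial.map_mul, Polynomial.map_C, Polynomial.eval_add,
    Polynomial.eval_mul, Polynomial.eval_C, h1, h2, mul_zero, add_zero] at h3
  exact h3.symm

section

variable {x : ℝ × ℝ → E3} {q : ℝ × ℝ}

/-- Where a component of the normal vector does not vanish, the other two coordinates map the
surface onto a neighbourhood. -/
theorem eventually_of_eventually_comp (hx : AnalyticAt ℝ x q) {i j : Fin 3}
    (hn : pd (1, 0) x q i * pd (0, 1) x q j - pd (1, 0) x q j * pd (0, 1) x q i ≠ 0)
    {R : (Fin 2 → ℝ) → Prop} (hR : ∀ᶠ p in 𝓝 q, R ![x p i, x p j]) :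
    ∀ᶠ y in 𝓝 ![x q i, x q j], R y := by
  set T : E3 →L[ℝ] (Fin 2 → ℝ) := ContinuousLinearMap.pi
    ![ContinuousLinearMap.proj i, ContinuousLinearMap.proj j] with hT
  have hTv : ∀ v, T v = ![v i, v j] := by
    intro v
    ext k
    fin_cases k <;> rfl
  have hd : HasStrictFDerivAt (fun p => T (x p)) (T.comp (fderiv ℝ x q)) q :=
    T.hasStrictFDerivAt.comp q hx.hasStrictFDerivAt
  set d := pd (1, 0) x q i * pd (0, 1) x q j - pd (1, 0) x q j * pd (0, 1) x q i
  have hsurj : (T.comp (fderiv ℝ x q)).range = ⊤ := by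
    rw [LinearMap.range_eq_top]
    intro y
    refine ⟨((y 0 * pd (0, 1) x q j - y 1 * pd (0, 1) x q i) / d,
      (pd (1, 0) x q i * y 1 - pd (1, 0) x q j * y 0) / d), ?_⟩
    change T (fderiv ℝ x q _) = y
    rw [fderiv_apply_eq_pd, hTv]
    ext k
    fin_cases k
    · simp only [Fin.zero_eta, Matrix.cons_val_zero, Pi.add_apply, Pi.smul_apply, smul_eq_mul]
      rw [div_mul_eq_mul_div, div_mul_eq_mul_div, ← add_div, div_eq_iff hn]
      ring
    · simp only [Fin.mk_one, Matrix.cons_val_one, Pi.add_apply, Pi.smul_apply, smul_eq_mul,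
        Matrix.cons_val_fin_one]
      rw [div_mul_eq_mul_div, div_mul_eq_mul_div, ← add_div, div_eq_iff hn]
      ring
  have hmap := hd.map_nhds_eq_of_surj hsurj
  rw [← hTv, ← hmap, Filter.eventually_map]
  simpa only [hTv] using hR

/-- A polynomial vanishing on a piece of surface is divisible by every irreducible polynomial
vanishing there: otherwise an eliminant would vanish on an open set of the plane. -/
theorem dvd_of_eventually_eval_eq_zero {F G : MvPolynomial (Fin 3) ℝ} (hF : Irreducible F)
    (hx : AnalyticAt ℝ x q) (hn : nrm x q ≠ 0)
    (hFx : ∀ᶠ p in 𝓝 q, MvPolynomial.eval (x p) F = 0)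
    (hGx : ∀ᶠ p in 𝓝 q, MvPolynomial.eval (x p) G = 0) : F ∣ G := by
  by_contra hFG
  obtain ⟨k, hk⟩ : ∃ k, nrm x q k ≠ 0 := by
    by_contra! h
    exact hn (funext h)
  set σ : Equiv.Perm (Fin 3) := Equiv.swap 0 k with hσ
  set E := MvPolynomial.renameEquiv ℝ σ
  have hE : ∀ (p : E3) (f : MvPolynomial (Fin 3) ℝ),
      MvPolynomial.eval (fun i => p (σ i)) (E f) = MvPolynomial.eval p f := by
    intro p f
    change MvPolynomial.eval _ (MvPolynomial.rename σ f) = _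
    rw [MvPolynomial.eval_rename]
    congr 1
    congr 1
    funext i
    simp [hσ]
  obtain ⟨H, hH0, hH⟩ := exists_eliminant (F := E F) (G := E G)
    ((MulEquiv.irreducible_iff E.toMulEquiv).2 hF) fun h => hFG ((map_dvd_iff E).1 h)
  apply hH0
  have hdet : pd (1, 0) x q (σ 1) * pd (0, 1) x q (σ 2) -
      pd (1, 0) x q (σ 2) * pd (0, 1) x q (σ 1) ≠ 0 := by
    have h0 : nrm x q 0 = pd (1, 0) x q 1 * pd (0, 1) x q 2 - pd (1, 0) x q 2 * pd (0, 1) x q 1 :=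
      cross_zero' _ _
    have h1 : nrm x q 1 = pd (1, 0) x q 2 * pd (0, 1) x q 0 - pd (1, 0) x q 0 * pd (0, 1) x q 2 :=
      cross_one' _ _
    have h2 : nrm x q 2 = pd (1, 0) x q 0 * pd (0, 1) x q 1 - pd (1, 0) x q 1 * pd (0, 1) x q 0 :=
      cross_two' _ _
    fin_cases k
    · have e1 : σ 1 = 1 := by simp [hσ]
      have e2 : σ 2 = 2 := by simp [hσ]
      rw [e1, e2, ← h0]; exact hk
    · have e1 : σ 1 = 0 := by simp [hσ]
      have e2 : σ 2 = 2 := by rw [hσ]; decide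
      rw [e1, e2]
      intro h; apply hk
      simp only [Fin.mk_one]
      rw [h1]; linarith
    · have e1 : σ 1 = 1 := by rw [hσ]; decide
      have e2 : σ 2 = 0 := by simp [hσ]
      rw [e1, e2]
      intro h; apply hk
      simp only [Fin.reduceFinMk]
      rw [h2]; linarith
  refine mvPolynomial_eq_zero_of_eventually (p := ![x q (σ 1), x q (σ 2)])
    (eventually_of_eventually_comp hx hdet ?_)
  filter_upwards [hFx, hGx] with p h1 h2
  have := hH (fun i => x p (σ i)) ((hE _ _).trans h1) ((hE _ _).trans h2)
  have hv : ![x p (σ 1), x p (σ 2)] = fun i : Fin 2 => x p (σ i.succ) := by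
    funext i
    fin_cases i <;> rfl
  rw [hv]
  exact this

end

/-! ### Polynomials along the flow of a linear vector field -/

theorem hasDerivAt_eval (F : MvPolynomial (Fin 3) ℝ) {γ : ℝ → E3} {w : E3} {t : ℝ}
    (hγ : HasDerivAt γ w t) : HasDerivAt (fun t => MvPolynomial.eval (γ t) F)
      (∑ i, MvPolynomial.eval (γ t) (MvPolynomial.pderiv i F) * w i) t := by
  induction F using MvPolynomial.induction_on with
  | C c => simpa using hasDerivAt_const t c
  | add p q hp hq =>
    simp only [map_add, add_mul, Finset.sum_add_distrib]
    exact hp.add hq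
  | mul_X p j hp =>
    simp only [map_mul, MvPolynomial.eval_X, MvPolynomial.pderiv_mul, map_add, add_mul,
      Finset.sum_add_distrib]
    refine (hp.mul (hasDerivAt_pi.1 hγ j)).congr_deriv ?_
    congr 1
    · rw [Finset.sum_mul]
      exact Finset.sum_congr rfl fun i _ => by ring
    · rw [Finset.sum_eq_single j]
      · simp
      · intro i _ hij
        simp [MvPolynomial.pderiv_X_of_ne hij.symm]
      · simp

/-- The derivative of a polynomial along the linear vector field `p ↦ M (p - a)`. -/
noncomputable def lieDeriv (M : Matrix (Fin 3) (Fin 3) ℝ) (a : E3) (F : MvPolynomial (Fin 3) ℝ) :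
    MvPolynomial (Fin 3) ℝ :=
  ∑ i, MvPolynomial.pderiv i F *
    ∑ j, MvPolynomial.C (M i j) * (MvPolynomial.X j - MvPolynomial.C (a j))

theorem eval_lieDeriv (M : Matrix (Fin 3) (Fin 3) ℝ) (a : E3) (F : MvPolynomial (Fin 3) ℝ)
    (p : E3) : MvPolynomial.eval p (lieDeriv M a F) =
      ∑ i, MvPolynomial.eval p (MvPolynomial.pderiv i F) * (M *ᵥ (p - a)) i := by
  simp [lieDeriv, Matrix.mulVec, dotProduct]

/-- If a polynomial divides its derivative along a vector field, then its zero set is invariant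
under the flow. -/
theorem eval_eq_zero_of_dvd {M : Matrix (Fin 3) (Fin 3) ℝ} {a : E3} {F : MvPolynomial (Fin 3) ℝ}
    (hdvd : F ∣ lieDeriv M a F) {γ : ℝ → E3} (hγ : ∀ t, HasDerivAt γ (M *ᵥ (γ t - a)) t)
    (h0 : MvPolynomial.eval (γ 0) F = 0) (t : ℝ) : MvPolynomial.eval (γ t) F = 0 := by
  obtain ⟨H, hH⟩ := hdvd
  have hd : ∀ t, HasDerivAt (fun t => MvPolynomial.eval (γ t) F)
      (MvPolynomial.eval (γ t) F * MvPolynomial.eval (γ t) H) t := fun t =>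
    (hasDerivAt_eval F (hγ t)).congr_deriv (by rw [← eval_lieDeriv, hH, map_mul])
  have hm : (0 : ℝ) ∈ Set.Ioo (-(|t| + 1)) (|t| + 1) := by
    constructor <;> linarith [abs_nonneg t]
  have hm' : t ∈ Set.Ioo (-(|t| + 1)) (|t| + 1) := by
    constructor <;> linarith [neg_abs_le t, le_abs_self t]
  obtain ⟨K, hK⟩ := exists_antiderivative (l := -(|t| + 1)) (r := |t| + 1)
    (f := fun t => MvPolynomial.eval (γ t) H) fun t _ =>
      (hasDerivAt_eval H (hγ t)).continuousAt.continuousWithinAt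
  have h1 := eq_of_hasDerivAt_zero
    (f := fun t => MvPolynomial.eval (γ t) F * Real.exp (-K t))
    (fun t ht => ((hd t).mul (hK t ht).neg.exp).congr_deriv (by ring)) hm' hm
  simp only [h0, zero_mul] at h1
  exact (mul_eq_zero.1 h1).resolve_right (Real.exp_pos _).ne'

section

variable {M : Matrix (Fin 3) (Fin 3) ℝ} {a : E3} {x : ℝ × ℝ → E3} {q : ℝ × ℝ}
  {F : MvPolynomial (Fin 3) ℝ}

/-- The equation of a surface that is tangent to a linear vector field divides its own derivative
along the field. -/
theorem dvd_lieDeriv (hF : Irreducible F) (hx : AnalyticAt ℝ x q) (hn : nrm x q ≠ 0)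
    (hFx : ∀ᶠ p in 𝓝 q, MvPolynomial.eval (x p) F = 0)
    (ht : ∀ᶠ p in 𝓝 q, nrm x p ⬝ᵥ (M *ᵥ (x p - a)) = 0) : F ∣ lieDeriv M a F := by
  obtain ⟨α, β, -, -, hw⟩ := exists_tangent_coefficients hx hn ht
  refine dvd_of_eventually_eval_eq_zero hF hx hn hFx ?_
  filter_upwards [hw, hFx.eventually_nhds, hx.eventually_analyticAt] with p h1 h2 h3
  obtain ⟨s, t⟩ := p
  have hcs : ContinuousAt (fun s' : ℝ => (s', t)) s := by fun_prop
  have hct : ContinuousAt (fun t' : ℝ => (s, t')) t := by fun_prop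
  have hu := (hasDerivAt_eval F (hasDerivAt_fst h3)).unique
    ((hasDerivAt_const s (0 : ℝ)).congr_of_eventuallyEq (hcs.eventually h2))
  have hv := (hasDerivAt_eval F (hasDerivAt_snd h3)).unique
    ((hasDerivAt_const t (0 : ℝ)).congr_of_eventuallyEq (hct.eventually h2))
  rw [eval_lieDeriv, h1]
  have : ∀ i, MvPolynomial.eval (x (s, t)) (MvPolynomial.pderiv i F) *
      (α (s, t) • pd (1, 0) x (s, t) + β (s, t) • pd (0, 1) x (s, t)) i =
      α (s, t) * (MvPolynomial.eval (x (s, t)) (MvPolynomial.pderiv i F) * pd (1, 0) x (s, t) i) +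
      β (s, t) * (MvPolynomial.eval (x (s, t)) (MvPolynomial.pderiv i F) * pd (0, 1) x (s, t) i) :=
    fun i => by simp only [Pi.add_apply, Pi.smul_apply, smul_eq_mul]; ring
  rw [Finset.sum_congr rfl fun i _ => this i, Finset.sum_add_distrib, ← Finset.mul_sum,
    ← Finset.mul_sum, hu, hv, mul_zero, mul_zero, add_zero]

/-- A surface patch in the zero set of a nonzero polynomial that is invariant under a linear flow
is tangent to the flow: otherwise the flow would sweep out an open set. -/
theorem nrm_dot_eq_zero_of_invariant {φ : ℝ → Matrix (Fin 3) (Fin 3) ℝ} (hF : F ≠ 0)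
    (hx : AnalyticAt ℝ x q) (hφ : ∀ v, ContDiff ℝ 1 fun t => φ t *ᵥ v) (h0 : φ 0 = 1)
    (hd : ∀ v, HasDerivAt (fun t => φ t *ᵥ v) (M *ᵥ v) 0)
    (hinv : ∀ᶠ p in 𝓝 q, ∀ t, MvPolynomial.eval (moveAbout a (φ t) (x p)) F = 0) :
    nrm x q ⬝ᵥ (M *ᵥ (x q - a)) = 0 := by
  by_contra hne
  apply hF
  set Ψ : (ℝ × ℝ) × ℝ → E3 := fun r => moveAbout a (φ r.2) (x r.1) with hΨ
  have hΨc : ContDiffAt ℝ 1 Ψ (q, 0) := by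
    have h1 : ContDiffAt ℝ 1 (fun r : (ℝ × ℝ) × ℝ => x r.1 - a) (q, 0) :=
      (ContDiffAt.comp (q, (0 : ℝ)) (g := x) (f := Prod.fst) hx.contDiffAt contDiffAt_fst).sub
        contDiffAt_const
    refine contDiffAt_const.add (contDiffAt_pi.2 fun i => ?_)
    simp only [Matrix.mulVec, dotProduct]
    refine ContDiffAt.sum fun j _ => ContDiffAt.mul ?_ (contDiffAt_pi.1 h1 j)
    have h2 := contDiff_pi.1 (hφ (Pi.single j 1)) i
    simp only [Matrix.mulVec_single_one, Matrix.col_apply] at h2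
    exact h2.contDiffAt.comp (q, (0 : ℝ)) contDiffAt_snd
  have hs := hΨc.hasStrictFDerivAt (by simp)
  have hw : fderiv ℝ Ψ (q, 0) ((0, 0), 1) = M *ᵥ (x q - a) := by
    have h1 : HasDerivAt (fun t : ℝ => (q, t)) ((0, 0), 1) 0 :=
      (hasDerivAt_const 0 q).prodMk (hasDerivAt_id 0)
    have h2 := hs.hasFDerivAt.comp_hasDerivAt (0 : ℝ) h1
    exact h2.unique ((hd (x q - a)).const_add a)
  have hT : ∀ h : ℝ × ℝ, fderiv ℝ Ψ (q, 0) (h, 0) = fderiv ℝ x q h := by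
    intro h
    have h1 : HasFDerivAt (fun p : ℝ × ℝ => (p, (0 : ℝ)))
        (ContinuousLinearMap.inl ℝ (ℝ × ℝ) ℝ) q := (ContinuousLinearMap.inl ℝ (ℝ × ℝ) ℝ).hasFDerivAt
    have h2 := hs.hasFDerivAt.comp q h1
    have h3 : Ψ ∘ (fun p : ℝ × ℝ => (p, (0 : ℝ))) = x := by
      funext p
      simp [hΨ, moveAbout, h0]
    rw [h3] at h2
    exact (DFunLike.congr_fun h2.fderiv h).symm
  have htr : triple (dU x q) (dV x q) (M *ᵥ (x q - a)) ≠ 0 := by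
    rw [triple, triple_product_permutation, triple_product_permutation, dotProduct_comm]
    exact hne
  set d := triple (dU x q) (dV x q) (M *ᵥ (x q - a)) with hdd
  have hsurj : (fderiv ℝ Ψ (q, 0)).range = ⊤ := by
    rw [LinearMap.range_eq_top]
    intro v
    have hv := triple_smul_eq (dU x q) (dV x q) (M *ᵥ (x q - a)) v
    rw [← hdd] at hv
    generalize v ⬝ᵥ (dV x q) ⨯₃ (M *ᵥ (x q - a)) = c₁ at hv
    generalize v ⬝ᵥ (M *ᵥ (x q - a)) ⨯₃ (dU x q) = c₂ at hv
    generalize v ⬝ᵥ (dU x q) ⨯₃ (dV x q) = c₃ at hv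
    refine ⟨d⁻¹ • (((c₁, c₂), (0 : ℝ)) + c₃ • ((0, 0), (1 : ℝ))), ?_⟩
    change fderiv ℝ Ψ (q, 0) _ = v
    rw [map_smul, map_add, map_smul, hw, hT, fderiv_apply_eq_pd, ← dU_eq_pd, ← dV_eq_pd, ← hv,
      smul_smul, inv_mul_cancel₀ htr, one_smul]
  have hmap := hs.map_nhds_eq_of_surj hsurj
  refine mvPolynomial_eq_zero_of_eventually (p := Ψ (q, 0)) ?_
  rw [← hmap, Filter.eventually_map]
  exact (continuousAt_fst (p := (q, (0 : ℝ)))).eventually hinv |>.mono fun r hr => hr r.2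

end

/-! ### The two conditions and the tangent linear field -/

section

variable {M : Matrix (Fin 3) (Fin 3) ℝ} {a e : E3}

theorem nrm_ne_zero (X : Patch) {q : ℝ × ℝ} (hq : q ∈ X.dom) : nrm X.map q ≠ 0 :=
  X.regular q hq

theorem cross_ne_zero_of_notMem_span {h e : E3} (he : e ≠ 0) (hh : h ∉ Submodule.span ℝ {e}) :
    h ⨯₃ e ≠ 0 := fun h0 => by
  obtain ⟨c, hc⟩ := cross_eq_zero he h0
  exact hh (Submodule.mem_span_singleton.2 ⟨c, hc.symm⟩)

theorem finrank_span_pair {h e : E3} (hh : h ⨯₃ e ≠ 0) :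
    Module.finrank ℝ (Submodule.span ℝ {h, e}) = 2 := by
  have hli : LinearIndependent ℝ ![h, e] := by
    rw [LinearIndependent.pair_iff]
    intro s t hst
    have h1 : s • (h ⨯₃ e) = 0 := by
      have := congrArg (fun w => w ⨯₃ e) hst
      simpa using this
    have h2 : t • (h ⨯₃ e) = 0 := by
      have := congrArg (fun w => h ⨯₃ w) hst
      simpa using this
    exact ⟨(smul_eq_zero.1 h1).resolve_right hh, (smul_eq_zero.1 h2).resolve_right hh⟩
  have := finrank_span_eq_card hli
  rwa [Matrix.range_cons, Matrix.range_cons, Matrix.range_empty, Set.union_empty,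
    Fintype.card_fin] at this

/-- A surface tangent to the generator of an affine rotation group has both properties.  The common
direction along the meridian in the plane of `h` and `e` is the value of the field on `h`. -/
theorem properties_of_tangent {P : Set Patch} (he : e ≠ 0) (hM : M.trace = 0)
    (hker : ∀ w, M *ᵥ w = 0 ↔ w ∈ Submodule.span ℝ {e})
    (ht : ∀ X ∈ P, ∀ q ∈ X.dom, nrm X.map q ⬝ᵥ (M *ᵥ (X.map q - a)) = 0) :
    AffineNormalsMeet P (AffineSubspace.mk' a (Submodule.span ℝ {e})) ∧
      HasShadowLineProperty P (AffineSubspace.mk' a (Submodule.span ℝ {e})) := by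
  have hMe : M *ᵥ e = 0 := (hker e).2 (Submodule.mem_span_singleton_self e)
  constructor
  · intro X hX q hq hK
    have hx := X.analytic q hq
    have hD := (gaussCurvature_ne_zero_iff hx (nrm_ne_zero X hq)).1 hK
    refine (meetsLine_affineNormal_iff hx hD he).2 ?_
    refine triple_normalVec_of_tangent hM hMe (fun w hw => ?_) hx hD ?_
    · obtain ⟨c, hc⟩ := Submodule.mem_span_singleton.1 ((hker w).1 hw)
      exact ⟨c, hc.symm⟩
    · filter_upwards [X.isOpen_dom.mem_nhds hq] with p hp using ht X hX p hp
  · intro H hAH hH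
    have hle : Submodule.span ℝ {e} ≤ H.direction := by
      simpa only [AffineSubspace.direction_mk'] using AffineSubspace.direction_le hAH
    have haH : a ∈ H := hAH (AffineSubspace.self_mem_mk' a _)
    obtain ⟨h, hhH, hh⟩ : ∃ h ∈ H.direction, h ∉ Submodule.span ℝ {e} := by
      by_contra! hcon
      have := le_antisymm hle hcon
      rw [← this, finrank_span_singleton he] at hH
      norm_num at hH
    have hspan : Submodule.span ℝ {h, e} = H.direction := by
      refine Submodule.eq_of_le_of_finrank_eq ?_ ?_
      · rw [Submodule.span_le]
        rintro w (rfl | rfl)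
        · exact hhH
        · exact hle (Submodule.mem_span_singleton_self _)
      · rw [hH, finrank_span_pair (cross_ne_zero_of_notMem_span he hh)]
    refine ⟨M *ᵥ h, fun h0 => hh ((hker h).1 h0), fun X hX q hq hqH hqA => ?_⟩
    have hd : X.map q - a ∈ H.direction := by
      simpa using AffineSubspace.vsub_mem_direction hqH haH
    rw [← hspan, Submodule.mem_span_pair] at hd
    obtain ⟨s, t, hst⟩ := hd
    have hs : s ≠ 0 := by
      rintro rfl
      exact hqA (mem_line_iff.2 ⟨t, by rw [← hst, zero_smul, zero_add]⟩)
    rw [mem_tangentPlane_iff (nrm_ne_zero X hq)]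
    have h1 := ht X hX q hq
    rw [← hst, Matrix.mulVec_add, Matrix.mulVec_smul, Matrix.mulVec_smul, hMe, smul_zero, add_zero,
      dotProduct_smul, smul_eq_mul] at h1
    exact (mul_eq_zero.1 h1).resolve_left hs

/-- A non-developable surface with both properties is, near some point, tangent to the generator
of an affine rotation group. -/
theorem exists_generator_of_properties {P : Set Patch} (he : e ≠ 0)
    (hN : AffineNormalsMeet P (AffineSubspace.mk' a (Submodule.span ℝ {e})))
    (hS : HasShadowLineProperty P (AffineSubspace.mk' a (Submodule.span ℝ {e}))) {X : Patch}
    (hX : X ∈ P) {q : ℝ × ℝ} (hq : q ∈ X.dom) (hK : gaussCurvature X.map q ≠ 0) :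
    ∃ M : Matrix (Fin 3) (Fin 3) ℝ, M.trace = 0 ∧
      (∀ w, M *ᵥ w = 0 ↔ w ∈ Submodule.span ℝ {e}) ∧
      ∃ q ∈ X.dom, ∀ᶠ p in 𝓝 q, nrm X.map p ⬝ᵥ (M *ᵥ (X.map p - a)) = 0 := by
  have hD := (gaussCurvature_ne_zero_iff (X.analytic q hq) (nrm_ne_zero X hq)).1 hK
  obtain ⟨M, hM, hMe, hM0, q', hq', hD', ht⟩ := exists_generator (a := a) X.isOpen_dom X.analytic he
    (fun p hp hDp => (meetsLine_affineNormal_iff (X.analytic p hp) hDp he).1 (hN X hX p hp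
      ((gaussCurvature_ne_zero_iff (X.analytic p hp) (nrm_ne_zero X hp)).2 hDp))) (fun h hh => by
      obtain ⟨v, hv, hvt⟩ := hS (AffineSubspace.mk' a (Submodule.span ℝ {h, e}))
        ((AffineSubspace.mk'_le_mk'_iff a).2 (Submodule.span_mono (by simp)))
        (by rw [AffineSubspace.direction_mk', finrank_span_pair hh])
      refine ⟨v, hv, fun p hp _ hpH => ?_⟩
      obtain ⟨s, hs, t, hst⟩ := hpH
      refine (mem_tangentPlane_iff (nrm_ne_zero X hp) v).1 (hvt X hX p hp ?_ ?_)
      · rw [AffineSubspace.mem_mk', vsub_eq_sub, Submodule.mem_span_pair]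
        exact ⟨s, t, hst.symm⟩
      · rw [mem_line_iff]
        rintro ⟨c, hc⟩
        apply hh
        have := congrArg (fun w => w ⨯₃ e) (hst.symm.trans hc)
        simpa [hs] using this) hq hD
  refine ⟨M, hM, fun w => ⟨fun hw => ?_, fun hw => ?_⟩, q', hq', ht⟩
  · obtain ⟨c, rfl⟩ := ker_of_tangent he hMe hM0 (X.analytic q' hq') hD' ht w hw
    exact Submodule.smul_mem _ _ (Submodule.mem_span_singleton_self e)
  · obtain ⟨c, rfl⟩ := Submodule.mem_span_singleton.1 hw
    rw [Matrix.mulVec_smul, hMe, smul_zero]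

/-- All points of the axis define the same affine maps. -/
theorem moveAbout_eq_of_mem {D : Submodule ℝ E3} {φ : ℝ → Matrix (Fin 3) (Fin 3) ℝ}
    (hφ : IsRotationGroup D φ) {a b : E3} (hb : b ∈ AffineSubspace.mk' a D) (t : ℝ) (p : E3) :
    moveAbout b (φ t) p = moveAbout a (φ t) p := by
  have h := (hφ.fixed_iff (b - a)).2 (by simpa using hb) t
  have h2 : p - a = (p - b) + (b - a) := by abel
  rw [moveAbout, moveAbout, h2, Matrix.mulVec_add, h]
  abel

end

/-! ### Invariance of parametrized surfaces -/

section

variable {a e : E3} {X : Patch}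

theorem Patch.properties_of_isAffineRotationSurface (he : e ≠ 0)
    (h : X.IsAffineRotationSurface (AffineSubspace.mk' a (Submodule.span ℝ {e}))) :
    AffineNormalsMeet {X} (AffineSubspace.mk' a (Submodule.span ℝ {e})) ∧
      HasShadowLineProperty {X} (AffineSubspace.mk' a (Submodule.span ℝ {e})) := by
  obtain ⟨φ, hφ, hinv⟩ := h
  rw [AffineSubspace.direction_mk'] at hφ
  obtain ⟨M, hM, hker, hd⟩ := hφ.exists_generator
  refine properties_of_tangent he hM hker ?_
  rintro X rfl q hq
  have h0 : moveAbout a (φ 0) (X.map q) = X.map q := by simp [moveAbout, hφ.map_zero]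
  refine nrm_dot_eq_zero_of_curve (X.analytic q hq) (nrm_ne_zero X hq)
    (γ := fun t => moveAbout a (φ t) (X.map q)) ?_ h0
    (hinv a (AffineSubspace.self_mem_mk' a _) q hq)
  exact (hd (X.map q - a)).const_add a

theorem Patch.isAffineRotationSurface_of_properties (he : e ≠ 0) (hX : IsConnected X.dom)
    (hK : NotDevelopable {X})
    (hN : AffineNormalsMeet {X} (AffineSubspace.mk' a (Submodule.span ℝ {e})))
    (hS : HasShadowLineProperty {X} (AffineSubspace.mk' a (Submodule.span ℝ {e}))) :
    X.IsAffineRotationSurface (AffineSubspace.mk' a (Submodule.span ℝ {e})) := by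
  obtain ⟨X, rfl, q, hq, hKq⟩ := hK
  obtain ⟨M, hM, hker, q', hq', ht⟩ := exists_generator_of_properties he hN hS rfl hq hKq
  obtain ⟨φ, hφ, hd⟩ := exists_isRotationGroup hM hker
  have han : AnalyticOnNhd ℝ (fun p => nrm X.map p ⬝ᵥ (M *ᵥ (X.map p - a))) X.dom := by
    intro p hp
    have h1 := analyticAt_nrm (X.analytic p hp)
    have h2 : AnalyticAt ℝ (fun p => M *ᵥ (X.map p - a)) p :=
      (LinearMap.toContinuousLinearMap (Matrix.mulVecLin M)).analyticAt _ |>.comp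
        ((X.analytic p hp).sub analyticAt_const)
    rw [analyticAt_pi_iff] at h1 h2
    simp only [dotProduct]
    exact Finset.analyticAt_fun_sum _ fun i _ => (h1 i).mul (h2 i)
  -- Tangency spreads from a neighbourhood of `q'` to the connected domain by analyticity.
  have hall := han.eqOn_zero_of_preconnected_of_eventuallyEq_zero hX.isPreconnected hq' ht
  refine ⟨φ, by rwa [AffineSubspace.direction_mk'], fun b hb p hp V hV => ?_⟩
  simp only [moveAbout_eq_of_mem hφ hb]
  refine eventually_moveAbout_mem (X.analytic p hp) (nrm_ne_zero X hp) ?_ hφ.map_zero hd hV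
  filter_upwards [X.isOpen_dom.mem_nhds hp] with r hr using hall hr

end

/-! ### Invariance of zero sets of polynomials -/

section

variable {a e : E3} {F : MvPolynomial (Fin 3) ℝ}

theorem eventually_eval_eq_zero {X : Patch} (hX : X ∈ patchesOf (zeroSet F)) {q : ℝ × ℝ}
    (hq : q ∈ X.dom) : ∀ᶠ p in 𝓝 q, MvPolynomial.eval (X.map p) F = 0 := by
  filter_upwards [X.isOpen_dom.mem_nhds hq] with p hp using hX (Set.mem_image_of_mem _ hp)

theorem properties_of_isAffineRotationSet (he : e ≠ 0) (hF : F ≠ 0)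
    (h : IsAffineRotationSet (zeroSet F) (AffineSubspace.mk' a (Submodule.span ℝ {e}))) :
    AffineNormalsMeet (patchesOf (zeroSet F)) (AffineSubspace.mk' a (Submodule.span ℝ {e})) ∧
      HasShadowLineProperty (patchesOf (zeroSet F))
        (AffineSubspace.mk' a (Submodule.span ℝ {e})) := by
  obtain ⟨φ, hφ, hinv⟩ := h
  rw [AffineSubspace.direction_mk'] at hφ
  obtain ⟨M, hM, hker, hd⟩ := hφ.exists_generator
  have hd' := hasDerivAt_group_left hφ.map_add hd
  refine properties_of_tangent he hM hker fun X hX q hq => ?_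
  refine nrm_dot_eq_zero_of_invariant hF (X.analytic q hq) (fun v => ?_) hφ.map_zero hd ?_
  · rw [contDiff_one_iff_deriv]
    refine ⟨fun t => (hd' t v).differentiableAt, ?_⟩
    have hc : Continuous fun t => φ t *ᵥ v :=
      continuous_iff_continuousAt.2 fun t => (hd' t v).continuousAt
    rw [funext fun t => (hd' t v).deriv]
    exact (LinearMap.toContinuousLinearMap (Matrix.mulVecLin M)).continuous.comp hc
  · filter_upwards [eventually_eval_eq_zero hX hq] with p hp t
    exact hinv a (AffineSubspace.self_mem_mk' a _) t _ hp

theorem isAffineRotationSet_of_properties (he : e ≠ 0) (hF : Irreducible F)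
    (hK : NotDevelopable (patchesOf (zeroSet F)))
    (hN : AffineNormalsMeet (patchesOf (zeroSet F))
      (AffineSubspace.mk' a (Submodule.span ℝ {e})))
    (hS : HasShadowLineProperty (patchesOf (zeroSet F))
      (AffineSubspace.mk' a (Submodule.span ℝ {e}))) :
    IsAffineRotationSet (zeroSet F) (AffineSubspace.mk' a (Submodule.span ℝ {e})) := by
  obtain ⟨X, hX, q, hq, hKq⟩ := hK
  obtain ⟨M, hM, hker, q', hq', ht⟩ := exists_generator_of_properties he hN hS hX hq hKq
  obtain ⟨φ, hφ, hd⟩ := exists_isRotationGroup hM hker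
  have hdvd := dvd_lieDeriv hF (X.analytic q' hq') (nrm_ne_zero X hq')
    (eventually_eval_eq_zero hX hq') ht
  refine ⟨φ, by rwa [AffineSubspace.direction_mk'], fun b hb t p hp => ?_⟩
  rw [moveAbout_eq_of_mem hφ hb]
  refine eval_eq_zero_of_dvd hdvd (γ := fun t => moveAbout a (φ t) p)
    (fun t => hasDerivAt_moveAbout (hd t (p - a))) ?_ t
  have h0 : moveAbout a (φ 0) p = p := by simp [moveAbout, hφ.map_zero]
  rw [h0]
  exact hp

end

end AffineRotation


theorem theorem2 (A : AffineSubspace ℝ AffineRotation.E3) (hA : AffineRotation.IsLine A) :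
    (∀ X : AffineRotation.Patch, IsConnected X.dom → AffineRotation.NotDevelopable {X} →
      (X.IsAffineRotationSurface A ↔
        AffineRotation.AffineNormalsMeet {X} A ∧ AffineRotation.HasShadowLineProperty {X} A)) ∧
    (∀ F : MvPolynomial (Fin 3) ℝ, Irreducible F →
      AffineRotation.NotDevelopable (AffineRotation.patchesOf (AffineRotation.zeroSet F)) →
      (AffineRotation.IsAffineRotationSet (AffineRotation.zeroSet F) A ↔
        AffineRotation.AffineNormalsMeet
            (AffineRotation.patchesOf (AffineRotation.zeroSet F)) A ∧
          AffineRotation.HasShadowLineProperty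
            (AffineRotation.patchesOf (AffineRotation.zeroSet F)) A)) := by
  obtain ⟨a, e, he, rfl⟩ := hA
  exact ⟨fun X hX hK => ⟨AffineRotation.Patch.properties_of_isAffineRotationSurface he, fun h =>
      AffineRotation.Patch.isAffineRotationSurface_of_properties he hX hK h.1 h.2⟩,
    fun F hF hK => ⟨AffineRotation.properties_of_isAffineRotationSet he hF.ne_zero, fun h =>
      AffineRotation.isAffineRotationSet_of_properties he hF hK h.1 h.2⟩⟩
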